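/- **Setting.** Let $M$ be a finite-horizon MDP with finite non-empty state and action spaces $\mathcal S,\mathcal A$, horizon $H$, deterministic rewards $r_h:\mathcal S\times\mathcal A\to[0,1]$ and nominal transition vectors $P^o_{h,s,a}\in\Delta(\mathcal S)$, $h\in[H]$. For $\rho>0$ let $\mathcal P_{h,s,a}=\{P\in\Delta(\mathcal S): D_{\mathrm{KL}}(P,P^o_{h,s,a})\le\rho\}$, where $D_{\mathrm{KL}}(P,Q)=\sum_{s'}P(s')\log\frac{P(s')}{Q(s')}$ ($=\infty$ unless $P\ll Q$), let $\mathcal P=\bigotimes_{h,s,a}\mathcal P_{h,s,a}$, and write $L_{\mathcal P_{h,s,a}}V=\inf\{PV:P\in\mathcal P_{h,s,a}\}$. For a deterministic Markov policy $\pi$ let $V_h^{\pi}(s)=\inf_{P\in\mathcal P}\mathbb E_{\pi,P}[\sum_{t=h}^H r_t(s_t,a_t)\mid s_h=s]$, let $V_h^*=\sup_\pi V_h^\pi$, and $V^\pi=V^\pi_1$, $V^*=V_1^*$ (all of them are $0$ at time $H+1$). **Algorithm (RPVL).** Draw $N$ independent samples from each $P^o_{h,s,a}$ (all samples independent; $N_{\rm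 total}=N|\mathcal S||\mathcal A|H$), let $\widehat P^o_{h,s,a}$ be the empirical frequencies and $\widehat{\mathcal P}_{h,s,a}$ the KL ball of radius $\rho$ around $\widehat P^o_{h,s,a}$. Put $\widehat V_{H+1}=0$ and, for $h=H,\dots,1$, $\widehat V_h(s)=\max_a\{r_h(s,a)+L_{\widehat{\mathcal P}_{h,s,a}}\widehat V_{h+1}\}$, and let $\widehat\pi_h(s)$ be a maximizing action (ties broken arbitrarily). **Dual variable.** For $P\in\Delta(\mathcal S)$ and $V:\mathcal S\to[0,H]$ let $\lambda^*(P,V)$ be the minimizer over $\lambda\in[0,H/\rho]$ of $\lambda\rho+\lambda\log\mathbb E_{s'\sim P}[e^{-V(s')/\lambda}]$ (with value $-\min_{\operatorname{supp}P}V$ at $\lambda=0$). For $\lambda\in(0,1)$ put $$N_{\rm KL}(\lambda)=\frac{2e^{3H/\lambda}H^5|\mathcal S||\mathcal A|}{\rho^2\epsilon^2}\log\frac{8H|\mathcal S||\mathcal A|}{\lambda\delta}.$$ Let $\underline\lambda$ be the minimum over all $(h,s,a)$ of $\lambda^*/2$ if $\lambda^*:=\lambda^*(P^o_{h,s,a},V^*_{h+1})\in(0,1)$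 and of $1/2$ otherwise; it depends only on $M$ and $\rho$. **Theorem.** Let $\rho>0$ and $\delta\in(0,1)$. 1. There is $N_0$, depending on $M,\rho,\delta$ but not on $\epsilon$, such that for all $\epsilon\in(0,H)$ and all $N\ge N_0$ with $N_{\rm total}\ge N_{\rm KL}(\underline\lambda)$, with probability at least $1-\delta$: $\|V^*-V^{\widehat\pi}\|_\infty\le\epsilon$ (for every tie-breaking). 2. For all $\lambda\in(0,1)$, all $\epsilon\in(0,H)$ and all $N$ with $N_{\rm total}\ge N_{\rm KL}(\lambda)$ (no further lower bound on $N$), the probability is at most $\delta$ that $\|V^*-V^{\widehat\pi}\|_\infty>\epsilon$ for some tie-breaking while at every $(h,s,a)$ either $L_{\mathcal P_{h,s,a}}\widehat V_{h+1}=L_{\widehat{\mathcal P}_{h,s,a}}\widehat V_{h+1}$ or both $\lambda^*(P^o_{h,s,a},\widehat V_{h+1})\ge\lambda$ and $\lambda^*(\widehat P^o_{h,s,a},\widehat V_{h+1})\ge\lambda$. -/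

import Mathlib

open MeasureTheory ProbabilityTheory

noncomputable section

namespace RobustRL

/-! ### Kullback-Leibler balls, worst-case expectations and the dual variable -/

section KL

variable {S : Type*} [Fintype S]

/-- The Kullback-Leibler divergence `∑ q(s) log (q(s) / p(s))` of two probability vectors, equal to
`⊤` when `q` is not absolutely continuous with respect to `p` (and with `0 log 0 = 0`). -/
def klDist (q p : S → ℝ) : EReal :=
  open Classical in
  if ∀ s, p s = 0 → q s = 0 then ((∑ s, q s * Real.log (q s / p s) : ℝ) : EReal) else ⊤

/-- The KL ball of radius `ρ` around `p`, inside the probability simplex. -/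
def klBall (p : S → ℝ) (ρ : ℝ) : Set (S → ℝ) :=
  {q | q ∈ stdSimplex ℝ S ∧ klDist q p ≤ (ρ : EReal)}

/-- The worst-case expectation `inf {q V : q in the KL ball of radius ρ around p}`. -/
def worstCase (p : S → ℝ) (ρ : ℝ) (V : S → ℝ) : ℝ :=
  sInf ((fun q : S → ℝ => ∑ s, q s * V s) '' klBall p ρ)

/-- The dual objective `lam * ρ + lam * log (E_p exp (-V / lam))`; at `lam = 0` it takes its limit,
minus the minimum of `V` over the support of `p`. -/
def dualObjective (p : S → ℝ) (ρ : ℝ) (V : S → ℝ) (lam : ℝ) : ℝ :=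
  open Classical in
  if lam = 0 then -sInf (V '' {s | 0 < p s})
  else lam * ρ + lam * Real.log (∑ s, p s * Real.exp (-V s / lam))

/-- The optimal dual variable: the minimizer of the dual objective over `[0, B / ρ]`, for value
functions with values in `[0, B]`. (The minimizer is unique; `sInf` extracts it.) -/
def dualOptimizer (p : S → ℝ) (ρ B : ℝ) (V : S → ℝ) : ℝ :=
  sInf {lam | lam ∈ Set.Icc 0 (B / ρ) ∧
    IsMinOn (dualObjective p ρ V) (Set.Icc 0 (B / ρ)) lam}

end KL

/-! ### Finite-horizon Markov decision processes and robust values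

Time steps `1, …, H` are the elements of `Fin H`; value functions live at the times
`1, …, H + 1`, the elements of `Fin (H + 1)`. -/

/-- A finite-horizon MDP with (nominal) transition vectors `trans h s a` in the simplex and
deterministic rewards in `[0, 1]`. -/
structure MDP (S A : Type*) [Fintype S] (H : ℕ) where
  trans : Fin H → S → A → S → ℝ
  trans_mem : ∀ h s a, trans h s a ∈ stdSimplex ℝ S
  reward : Fin H → S → A → ℝ
  reward_mem : ∀ h s a, reward h s a ∈ Set.Icc (0 : ℝ) 1

/-- Deterministic non-stationary Markov policies. -/
abbrev Policy (S A : Type*) (H : ℕ) := Fin H → S → A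

section Values

variable {S A : Type*} [Fintype S] [DecidableEq S] {H : ℕ}

/-- The value at time `h` and state `s` of the policy `π` under the transition model `P`: the
expectation of `∑_{t ≥ h} r_t (s_t, π_t (s_t))` over the trajectories `(s_t)` with `s_h = s`. The
coordinates before time `h`, which play no role, are frozen at `s`, so that every trajectory from
time `h` on is counted exactly once. -/
def policyValue (r : Fin H → S → A → ℝ) (P : Fin H → S → A → S → ℝ) (π : Policy S A H)
    (h : Fin (H + 1)) (s : S) : ℝ :=
  ∑ x : Fin (H + 1) → S with ∀ t, t ≤ h → x t = s,
    (∏ t : Fin H with h ≤ t.castSucc,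
      P t (x t.castSucc) (π t (x t.castSucc)) (x t.succ)) *
    (∑ t : Fin H with h ≤ t.castSucc, r t (x t.castSucc) (π t (x t.castSucc)))

/-- The rectangular KL uncertainty set: at each `(h, s, a)` independently, any transition vector in
the KL ball around the nominal one. -/
def MDP.uncertaintySet (M : MDP S A H) (ρ : ℝ) : Set (Fin H → S → A → S → ℝ) :=
  {Q | ∀ h s a, Q h s a ∈ klBall (M.trans h s a) ρ}

/-- The robust value function of a policy: the infimum of its values over the uncertainty set. -/
def MDP.robustValue (M : MDP S A H) (ρ : ℝ) (π : Policy S A H) (h : Fin (H + 1)) (s : S) : ℝ :=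
  ⨅ Q : M.uncertaintySet ρ, policyValue M.reward Q.1 π h s

/-- The optimal robust value function. -/
def MDP.optRobustValue (M : MDP S A H) (ρ : ℝ) (h : Fin (H + 1)) (s : S) : ℝ :=
  ⨆ π : Policy S A H, M.robustValue ρ π h s

/-- The optimal dual variable at `(h, s, a)` for the optimal robust value function at the next
time. -/
def MDP.optDual (M : MDP S A H) (ρ : ℝ) (h : Fin H) (s : S) (a : A) : ℝ :=
  dualOptimizer (M.trans h s a) ρ H (M.optRobustValue ρ h.succ)

/-- The problem-dependent parameter: the minimum over all `(h, s, a)` of `lam / 2` if the optimal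
dual variable `lam` lies in `(0, 1)`, and of `1 / 2` otherwise. -/
def MDP.dualLowerBound (M : MDP S A H) (ρ : ℝ) : ℝ :=
  ⨅ i : Fin H × S × A,
    if 0 < M.optDual ρ i.1 i.2.1 i.2.2 ∧ M.optDual ρ i.1 i.2.1 i.2.2 < 1
    then M.optDual ρ i.1 i.2.1 i.2.2 / 2 else 1 / 2

/-! ### The algorithm -/

/-- A data set of `N` sampled next states for each time, state and action. -/
abbrev Dataset (S A : Type*) (H N : ℕ) := Fin H → S → A → Fin N → S

/-- The maximum likelihood estimate of the transition vectors: relative frequencies. -/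
def empirical {N : ℕ} (D : Dataset S A H N) (h : Fin H) (s : S) (a : A) (s' : S) : ℝ :=
  (Finset.card {i : Fin N | D h s a i = s'} : ℝ) / N

/-- The value functions computed by the algorithm, by backward recursion from `0` at time `H + 1`
with the empirical KL uncertainty sets. -/
def rpvlValue {N : ℕ} (r : Fin H → S → A → ℝ) (ρ : ℝ) (D : Dataset S A H N) :
    Fin (H + 1) → S → ℝ :=
  Fin.reverseInduction (motive := fun _ => S → ℝ) (fun _ => 0)
    (fun h V s => ⨆ a : A, (r h s a + worstCase (empirical D h s a) ρ V))

/-- `π` is an output of the algorithm on the data `D`: at each `(h, s)` it chooses a maximizing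
action, with ties broken in any way. -/
def IsRPVLOutput {N : ℕ} (r : Fin H → S → A → ℝ) (ρ : ℝ) (D : Dataset S A H N)
    (π : Policy S A H) : Prop :=
  ∀ h s a,
    r h s a + worstCase (empirical D h s a) ρ (rpvlValue r ρ D h.succ) ≤
      r h s (π h s) + worstCase (empirical D h s (π h s)) ρ (rpvlValue r ρ D h.succ)

/-- On the data `D` the optimal dual variables are bounded below by `lam`: at every `(h, s, a)`,
with `V` the value function of the algorithm at the next time, either the worst-case expectations of
`V` for the nominal and for the empirical transition vector agree, or both optimal dual variables
are at least `lam`. -/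
def MDP.DualsBoundedBelow {N : ℕ} (M : MDP S A H) (ρ lam : ℝ) (D : Dataset S A H N) : Prop :=
  ∀ h s a,
    worstCase (M.trans h s a) ρ (rpvlValue M.reward ρ D h.succ) =
        worstCase (empirical D h s a) ρ (rpvlValue M.reward ρ D h.succ) ∨
      (lam ≤ dualOptimizer (M.trans h s a) ρ H (rpvlValue M.reward ρ D h.succ) ∧
        lam ≤ dualOptimizer (empirical D h s a) ρ H (rpvlValue M.reward ρ D h.succ))

/-- The random data set `X` comes from the generative model of `M`: all samples are independent,
and those at `(h, s, a)` have the law `M.trans h s a`. -/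
structure IsGenerativeSample {N : ℕ} {Ω : Type*} [MeasurableSpace Ω] [MeasurableSpace S]
    (M : MDP S A H) (μ : Measure Ω) (X : Ω → Dataset S A H N) : Prop where
  measurable : ∀ h s a i, Measurable fun ω => X ω h s a i
  indep : iIndepFun (fun (j : Fin H × S × A × Fin N) ω => X ω j.1 j.2.1 j.2.2.1 j.2.2.2) μ
  law : ∀ h s a i s', μ.real {ω | X ω h s a i = s'} = M.trans h s a s'

/-- The sample size `N_KL` (with `nS` states and `nA` actions). -/
def sampleSizeKL (nS nA H : ℕ) (ρ ε δ lam : ℝ) : ℝ :=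
  2 * Real.exp (3 * H / lam) * (H : ℝ) ^ 5 * nS * nA / (ρ ^ 2 * ε ^ 2) *
    Real.log (8 * H * nS * nA / (lam * δ))

end Values

end RobustRL

end

noncomputable section

namespace RobustRL

/-! ### Strong duality for worst-case expectations over KL balls. -/

section KL

variable {S : Type*} [Fintype S]

/-! The worst-case expectation over a KL ball is the maximum over `lam ≥ 0` of minus
`dualObjective`, and for `lam > 0` the nominal distribution enters that objective only through the
expectation of `exp (-V / lam)`, an antitone function of `V`. Hence only the distribution function
of `V` matters: if it changes by at most `η` (`SublevelClose`), so do all these expectations, by the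
layer-cake formula. If both optimal dual variables are at least `lam₀`, the expectations are at
least `exp (-B / lam₀)`, and the worst cases differ by at most `B / ρ * exp (B / lam₀) * η`
(`SublevelClose.abs_worstCase_sub_le`).

For the bound on the event `DualsBoundedBelow`, this is applied with `B = H` at the algorithm's own
value functions, and the one-step errors add up to `2 * H` times a single one. The value function at
time `h + 1` is random but depends only on samples after time `h`, which are independent of those at
`(h, s, a)`; so Hoeffding's inequality still applies, with one threshold per state.

For the bound with `N₀`, errors are measured at the optimal value functions, which are
deterministic, and nothing is assumed about empirical dual variables. By convexity of the dual
objective, a small perturbation cannot push a positive optimal variable below `dualLowerBound`; if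
the optimal variable is zero, the worst case is the minimum over the support and the error is at
most `B / ρ * η` (`exists_abs_worstCase_sub_le`). Both facts need `η ≤ η₀` with `η₀` depending on
the MDP and `ρ` only, which is the source of `N₀`. The errors now propagate with the factor `H * (H
+ 1)`; the additional power of `H` is absorbed by the third exponential factor in `sampleSizeKL`,
since `η ^ 2` consumes only two. -/

theorem mem_klBall_iff {p q : S → ℝ} {ρ : ℝ} :
    q ∈ klBall p ρ ↔ q ∈ stdSimplex ℝ S ∧ (∀ s, p s = 0 → q s = 0) ∧
      ∑ s, q s * Real.log (q s / p s) ≤ ρ := by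
  unfold klBall klDist
  by_cases h : ∀ s, p s = 0 → q s = 0
  · simp only [Set.mem_ofPred_eq, if_pos h, EReal.coe_le_coe_iff]
    tauto
  · simp only [Set.mem_ofPred_eq, if_neg h]
    simp
    tauto

/-- The exponential moment of `-V / lam`, with `V` centered at `c`. -/
def expMoment (p V : S → ℝ) (c lam : ℝ) : ℝ := ∑ s, p s * Real.exp (-(V s - c) / lam)

/-- The minimum of `V` over the support of `p`. -/
def suppMin (p V : S → ℝ) : ℝ := sInf (V '' {s | 0 < p s})

theorem exists_pos_of_mem_stdSimplex {p : S → ℝ} (hp : p ∈ stdSimplex ℝ S) : ∃ s, 0 < p s := by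
  by_contra! h
  have : ∑ s, p s ≤ 0 := Finset.sum_nonpos fun s _ => h s
  linarith [hp.2]

theorem exists_eq_suppMin {p : S → ℝ} (hp : p ∈ stdSimplex ℝ S) (V : S → ℝ) :
    ∃ s, 0 < p s ∧ V s = suppMin p V := by
  obtain ⟨s, hs⟩ := exists_pos_of_mem_stdSimplex hp
  have hne : (V '' {s | 0 < p s}).Nonempty := ⟨_, s, hs, rfl⟩
  obtain ⟨t, ht, h⟩ := hne.csInf_mem (Set.toFinite _)
  exact ⟨t, ht, h⟩

theorem suppMin_le {p : S → ℝ} (V : S → ℝ) {s : S} (hs : 0 < p s) : suppMin p V ≤ V s :=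
  csInf_le (Set.toFinite _).bddBelow ⟨s, hs, rfl⟩

theorem expMoment_pos {p : S → ℝ} (hp : p ∈ stdSimplex ℝ S) (V : S → ℝ) (c lam : ℝ) :
    0 < expMoment p V c lam := by
  obtain ⟨s, hs⟩ := exists_pos_of_mem_stdSimplex hp
  exact Finset.sum_pos' (fun s _ => mul_nonneg (hp.1 s) (Real.exp_pos _).le)
    ⟨s, Finset.mem_univ _, mul_pos hs (Real.exp_pos _)⟩

theorem dualObjective_zero (p : S → ℝ) (ρ : ℝ) (V : S → ℝ) :
    dualObjective p ρ V 0 = -suppMin p V := by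
  simp [dualObjective, suppMin]

theorem dualObjective_eq {p : S → ℝ} (hp : p ∈ stdSimplex ℝ S) (ρ : ℝ) (V : S → ℝ) (c : ℝ)
    {lam : ℝ} (hlam : 0 < lam) :
    dualObjective p ρ V lam = lam * ρ - c + lam * Real.log (expMoment p V c lam) := by
  have h : ∑ s, p s * Real.exp (-V s / lam) = Real.exp (-c / lam) * expMoment p V c lam := by
    rw [expMoment, Finset.mul_sum]
    refine Finset.sum_congr rfl fun s _ => ?_
    rw [mul_left_comm, ← Real.exp_add]
    congr 2
    ring
  rw [dualObjective, if_neg hlam.ne', h, Real.log_mul (Real.exp_pos _).ne'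
    (expMoment_pos hp V c lam).ne', Real.log_exp]
  field_simp
  ring

theorem le_sum_mul_of_forall_le {q : S → ℝ} (hq : q ∈ stdSimplex ℝ S) {V : S → ℝ} {c : ℝ}
    (h : ∀ s, 0 < q s → c ≤ V s) : c ≤ ∑ s, q s * V s := by
  calc c = ∑ s, q s * c := by rw [← Finset.sum_mul, hq.2, one_mul]
    _ ≤ _ := Finset.sum_le_sum fun s _ => by
      rcases (hq.1 s).eq_or_lt with h0 | h0
      · simp [← h0]
      · exact mul_le_mul_of_nonneg_left (h s h0) h0.le

/-- Gibbs' variational inequality. -/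
theorem neg_dualObjective_le_lagrangian {p q : S → ℝ} (hp : p ∈ stdSimplex ℝ S)
    (hq : q ∈ stdSimplex ℝ S) (hqp : ∀ s, p s = 0 → q s = 0) (ρ : ℝ) (V : S → ℝ) {lam : ℝ}
    (hlam : 0 ≤ lam) :
    -dualObjective p ρ V lam ≤
      ∑ s, q s * V s + lam * (∑ s, q s * Real.log (q s / p s) - ρ) := by
  rcases hlam.eq_or_lt with rfl | hlam
  · rw [dualObjective_zero, neg_neg, zero_mul, add_zero]
    refine le_sum_mul_of_forall_le hq fun s hs => suppMin_le V ?_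
    exact (hp.1 s).lt_of_ne fun h => hs.ne' (hqp s h.symm)
  have hZ := expMoment_pos hp V 0 lam
  set Z := expMoment p V 0 lam with hZdef
  -- This is `log x ≤ x - 1` at the ratio of the tilted weight to `q s`, weighted by `q s`. The
  -- right-hand side sums to zero because both weights are probability vectors.
  have key : ∑ s, (-(q s * V s) / lam - q s * Real.log (q s / p s) - q s * Real.log Z) ≤
      ∑ s, (p s * Real.exp (-(V s - 0) / lam) / Z - q s) := by
    refine Finset.sum_le_sum fun s _ => ?_
    rcases (hq.1 s).eq_or_lt with h0 | h0
    · rw [← h0]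
      have : 0 ≤ p s * Real.exp (-(V s - 0) / lam) / Z :=
        div_nonneg (mul_nonneg (hp.1 s) (Real.exp_pos _).le) hZ.le
      simpa using this
    · have hps : 0 < p s := (hp.1 s).lt_of_ne fun h => h0.ne' (hqp s h.symm)
      have h1 := Real.log_le_sub_one_of_pos
        (show 0 < p s * Real.exp (-(V s - 0) / lam) / Z / q s by positivity)
      rw [Real.log_div (by positivity) h0.ne', Real.log_div (by positivity) hZ.ne',
        Real.log_mul hps.ne' (Real.exp_pos _).ne', Real.log_exp] at h1
      rw [Real.log_div h0.ne' hps.ne']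
      have h2 := mul_le_mul_of_nonneg_left h1 h0.le
      have h3 : q s * (p s * Real.exp (-(V s - 0) / lam) / Z / q s - 1) =
        p s * Real.exp (-(V s - 0) / lam) / Z - q s := by field_simp
      rw [h3] at h2
      refine le_trans (le_of_eq ?_) h2
      ring
  have hR : ∑ s, (p s * Real.exp (-(V s - 0) / lam) / Z - q s) = 0 := by
    rw [Finset.sum_sub_distrib, ← Finset.sum_div, hq.2]
    change Z / Z - 1 = 0
    rw [div_self hZ.ne', sub_self]
  rw [hR, Finset.sum_sub_distrib, Finset.sum_sub_distrib, ← Finset.sum_div, ← Finset.sum_mul, hq.2,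
    one_mul, Finset.sum_neg_distrib] at key
  rw [dualObjective_eq hp ρ V 0 hlam, ← hZdef]
  have h4 := mul_le_mul_of_nonneg_left key hlam.le
  have h5 : lam * (-(∑ s, q s * V s) / lam) = -(∑ s, q s * V s) := by field_simp
  have h6 : lam * (-(∑ s, q s * V s) / lam - ∑ s, q s * Real.log (q s / p s) - Real.log Z) =
    -(∑ s, q s * V s) - lam * ∑ s, q s * Real.log (q s / p s) - lam * Real.log Z := by
    rw [mul_sub, mul_sub, h5]
  rw [h6] at h4
  linarith

/-- Gibbs' variational inequality is an equality for the exponentially tilted distribution. -/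
theorem exists_neg_dualObjective_eq_lagrangian {p : S → ℝ} (hp : p ∈ stdSimplex ℝ S) (ρ : ℝ)
    (V : S → ℝ) {lam : ℝ} (hlam : 0 < lam) :
    ∃ q ∈ stdSimplex ℝ S, (∀ s, p s = 0 → q s = 0) ∧ -dualObjective p ρ V lam =
      ∑ s, q s * V s + lam * (∑ s, q s * Real.log (q s / p s) - ρ) := by
  have hZ := expMoment_pos hp V 0 lam
  set Z := expMoment p V 0 lam with hZdef
  have hsum : ∑ s, p s * Real.exp (-(V s - 0) / lam) / Z = 1 := by
    rw [← Finset.sum_div]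
    exact div_self hZ.ne'
  refine ⟨fun s => p s * Real.exp (-(V s - 0) / lam) / Z,
    ⟨fun s => div_nonneg (mul_nonneg (hp.1 s) (Real.exp_pos _).le) hZ.le, hsum⟩,
    fun s hs => by simp [hs], ?_⟩
  have h1 : ∀ s, p s * Real.exp (-(V s - 0) / lam) / Z *
      Real.log (p s * Real.exp (-(V s - 0) / lam) / Z / p s) =
      p s * Real.exp (-(V s - 0) / lam) / Z * V s * (-1 / lam) -
        p s * Real.exp (-(V s - 0) / lam) / Z * Real.log Z := by
    intro s
    rcases (hp.1 s).eq_or_lt with h0 | h0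
    · simp [← h0]
    · have : p s * Real.exp (-(V s - 0) / lam) / Z / p s = Real.exp (-(V s - 0) / lam) / Z := by
        field_simp
      rw [this, Real.log_div (Real.exp_pos _).ne' hZ.ne', Real.log_exp]
      ring
  simp only [h1]
  rw [Finset.sum_sub_distrib, ← Finset.sum_mul, ← Finset.sum_mul, hsum,
    dualObjective_eq hp ρ V 0 hlam, ← hZdef]
  field_simp
  ring

theorem neg_dualObjective_le_sum {p q : S → ℝ} {ρ : ℝ} (hp : p ∈ stdSimplex ℝ S)
    (hq : q ∈ klBall p ρ) (V : S → ℝ) {lam : ℝ} (hlam : 0 ≤ lam) :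
    -dualObjective p ρ V lam ≤ ∑ s, q s * V s := by
  obtain ⟨h1, h2, h3⟩ := mem_klBall_iff.1 hq
  have := neg_dualObjective_le_lagrangian hp h1 h2 ρ V hlam
  nlinarith

theorem self_mem_klBall {p : S → ℝ} {ρ : ℝ} (hp : p ∈ stdSimplex ℝ S) (hρ : 0 ≤ ρ) :
    p ∈ klBall p ρ := by
  refine mem_klBall_iff.2 ⟨hp, fun _ h => h, ?_⟩
  refine le_trans (le_of_eq (Finset.sum_eq_zero fun s _ => ?_)) hρ
  by_cases h : p s = 0
  · simp [h]
  · simp [div_self h]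

/-- The probability that `V` is at most `c`. -/
def sublevelProb (p V : S → ℝ) (c : ℝ) : ℝ := ∑ s with V s ≤ c, p s

theorem sublevelProb_suppMin_pos {p : S → ℝ} (hp : p ∈ stdSimplex ℝ S) (V : S → ℝ) :
    0 < sublevelProb p V (suppMin p V) := by
  obtain ⟨s, hs, h⟩ := exists_eq_suppMin hp V
  exact Finset.sum_pos' (fun s _ => hp.1 s) ⟨s, by simp [h], hs⟩

theorem sublevelProb_le_expMoment {p : S → ℝ} (hp : p ∈ stdSimplex ℝ S) (V : S → ℝ) (c : ℝ)
    {lam : ℝ} (hlam : 0 < lam) : sublevelProb p V c ≤ expMoment p V c lam := by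
  refine le_trans (Finset.sum_le_sum fun s hs => ?_) (Finset.sum_le_univ_sum_of_nonneg
    fun s => mul_nonneg (hp.1 s) (Real.exp_pos (-(V s - c) / lam)).le)
  have : V s ≤ c := by simpa using hs
  exact le_mul_of_one_le_right (hp.1 s) (Real.one_le_exp (div_nonneg (by linarith) hlam.le))

-- On the support, exponents above the minimum tend to `-∞`, so only the mass of the minimizers
-- survives.
open Filter Topology in
theorem tendsto_expMoment_suppMin {p : S → ℝ} (hp : p ∈ stdSimplex ℝ S) (V : S → ℝ) :
    Tendsto (expMoment p V (suppMin p V)) (𝓝[>] 0) (𝓝 (sublevelProb p V (suppMin p V))) := by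
  have h : ∀ s, Tendsto (fun lam : ℝ => p s * Real.exp (-(V s - suppMin p V) / lam)) (𝓝[>] 0)
      (𝓝 (if V s ≤ suppMin p V then p s else 0)) := by
    intro s
    rcases (hp.1 s).eq_or_lt with h0 | h0
    · simp [← h0]
    rcases (suppMin_le V h0).eq_or_lt with h1 | h1
    · simp [← h1]
    · rw [if_neg (not_le.2 h1)]
      have h2 : Tendsto (fun lam : ℝ => -(V s - suppMin p V) / lam) (𝓝[>] 0) atBot := by
        simp only [div_eq_mul_inv]
        exact tendsto_inv_nhdsGT_zero.const_mul_atTop_of_neg (by linarith)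
      simpa using (Real.tendsto_exp_atBot.comp h2).const_mul (p s)
  have := tendsto_finsetSum Finset.univ fun s _ => h s
  rw [← Finset.sum_filter] at this
  exact this

-- At `0` the centering at `suppMin p V` is essential: the moment then has a positive limit, so that
-- `lam` times its logarithm vanishes.
open Filter Topology in
theorem continuousOn_dualObjective {p : S → ℝ} (hp : p ∈ stdSimplex ℝ S) (ρ : ℝ) (V : S → ℝ) :
    ContinuousOn (dualObjective p ρ V) (Set.Ici 0) := by
  intro lam hlam
  rcases (show (0 : ℝ) ≤ lam from hlam).eq_or_lt with rfl | hlam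
  · rw [← continuousWithinAt_Ioi_iff_Ici]
    have hpm := sublevelProb_suppMin_pos hp V
    have h1 : Tendsto (fun lam => lam * ρ - suppMin p V +
        lam * Real.log (expMoment p V (suppMin p V) lam)) (𝓝[>] 0)
        (𝓝 (0 * ρ - suppMin p V +
          0 * Real.log (sublevelProb p V (suppMin p V)))) := by
      have h0 : Tendsto (fun lam : ℝ => lam) (𝓝[>] 0) (𝓝 0) := nhdsWithin_le_nhds
      exact ((h0.mul_const _).sub_const _).add
        (h0.mul ((tendsto_expMoment_suppMin hp V).log hpm.ne'))
    rw [ContinuousWithinAt, dualObjective_zero]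
    rw [zero_mul, zero_mul, zero_sub, add_zero] at h1
    refine h1.congr' ?_
    filter_upwards [self_mem_nhdsWithin] with x hx
    exact (dualObjective_eq hp ρ V _ hx).symm
  · have h : ContinuousAt (fun lam => lam * ρ - 0 + lam * Real.log (expMoment p V 0 lam)) lam := by
      unfold expMoment
      have : ∑ s, p s * Real.exp (-(V s - 0) / lam) ≠ 0 := (expMoment_pos hp V 0 lam).ne'
      have h0 := hlam.ne'
      fun_prop (disch := assumption)
    refine (h.congr ?_).continuousWithinAt
    filter_upwards [Ioi_mem_nhds hlam] with x hx
    exact (dualObjective_eq hp ρ V 0 hx).symm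

theorem differentiableAt_dualObjective {p : S → ℝ} (hp : p ∈ stdSimplex ℝ S) (ρ : ℝ) (V : S → ℝ)
    {lam : ℝ} (hlam : 0 < lam) : DifferentiableAt ℝ (dualObjective p ρ V) lam := by
  have h : DifferentiableAt ℝ
      (fun lam => lam * ρ - 0 + lam * Real.log (expMoment p V 0 lam)) lam := by
    unfold expMoment
    have : ∑ s, p s * Real.exp (-(V s - 0) / lam) ≠ 0 := (expMoment_pos hp V 0 lam).ne'
    have h0 := hlam.ne'
    fun_prop (disch := assumption)
  refine h.congr_of_eventuallyEq ?_
  filter_upwards [Ioi_mem_nhds hlam] with x hx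
  exact dualObjective_eq hp ρ V 0 hx

theorem suppMin_nonneg {p V : S → ℝ} (hp : p ∈ stdSimplex ℝ S) (hV : ∀ s, 0 ≤ V s) :
    0 ≤ suppMin p V := by
  obtain ⟨s, _, h⟩ := exists_eq_suppMin hp V
  exact h ▸ hV s

theorem dualObjective_nonneg_of_le {p : S → ℝ} (hp : p ∈ stdSimplex ℝ S) {ρ B : ℝ} (hρ : 0 < ρ)
    {V : S → ℝ} (hV : ∀ s, V s ≤ B) {lam : ℝ} (hlam : 0 < lam) (h : B / ρ ≤ lam) :
    0 ≤ dualObjective p ρ V lam := by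
  have h1 : B ≤ lam * ρ := (div_le_iff₀ hρ).1 h
  have h2 : 1 ≤ expMoment p V B lam := by
    rw [← hp.2]
    exact Finset.sum_le_sum fun s _ => le_mul_of_one_le_right (hp.1 s)
      (Real.one_le_exp (div_nonneg (by linarith [hV s]) hlam.le))
  have := mul_nonneg hlam.le (Real.log_nonneg h2)
  rw [dualObjective_eq hp ρ V B hlam]
  linarith

/-- Beyond `B / ρ` the objective is nonnegative, while at `0` it is minus a minimum of nonnegative
numbers. A positive minimizer, even at the endpoint `B / ρ`, is thus a local minimum in the line and
satisfies the first-order condition. -/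
theorem dualObjective_le_of_isMinOn {p : S → ℝ} (hp : p ∈ stdSimplex ℝ S) {ρ B : ℝ} (hρ : 0 < ρ)
    (hB : 0 ≤ B) {V : S → ℝ} (hV : ∀ s, V s ∈ Set.Icc 0 B) {lam : ℝ}
    (h : IsMinOn (dualObjective p ρ V) (Set.Icc 0 (B / ρ)) lam) {x : ℝ} (hx : 0 ≤ x) :
    dualObjective p ρ V lam ≤ dualObjective p ρ V x := by
  rcases le_or_gt x (B / ρ) with h1 | h1
  · exact h ⟨hx, h1⟩
  · have h2 := h (show (0 : ℝ) ∈ Set.Icc 0 (B / ρ) from ⟨le_rfl, div_nonneg hB hρ.le⟩)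
    have h3 := suppMin_nonneg hp fun s => (hV s).1
    have h4 := dualObjective_nonneg_of_le hp hρ (fun s => (hV s).2)
      (lt_of_le_of_lt (div_nonneg hB hρ.le) h1) h1.le
    rw [Set.mem_ofPred_eq, dualObjective_zero] at h2
    linarith

/-- The minimizers form a nonempty compact set, so `dualOptimizer` is the least of them; uniqueness
plays no role. -/
theorem exists_isMinOn_dualObjective {p : S → ℝ} (hp : p ∈ stdSimplex ℝ S) {ρ B : ℝ} (hρ : 0 < ρ)
    (hB : 0 ≤ B) (V : S → ℝ) :
    dualOptimizer p ρ B V ∈ Set.Icc 0 (B / ρ) ∧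
      IsMinOn (dualObjective p ρ V) (Set.Icc 0 (B / ρ)) (dualOptimizer p ρ B V) := by
  have hc : ContinuousOn (dualObjective p ρ V) (Set.Icc 0 (B / ρ)) :=
    (continuousOn_dualObjective hp ρ V).mono Set.Icc_subset_Ici_self
  obtain ⟨x, hx, hmin⟩ := isCompact_Icc.exists_isMinOn
    (Set.nonempty_Icc.2 (div_nonneg hB hρ.le)) hc
  have hset : {lam | lam ∈ Set.Icc 0 (B / ρ) ∧
      IsMinOn (dualObjective p ρ V) (Set.Icc 0 (B / ρ)) lam} =
      Set.Icc 0 (B / ρ) ∩ dualObjective p ρ V ⁻¹' Set.Iic (dualObjective p ρ V x) := by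
    ext y
    exact ⟨fun h => ⟨h.1, h.2 hx⟩, fun h => ⟨h.1, fun z hz =>
      show dualObjective p ρ V y ≤ dualObjective p ρ V z from
        le_trans (Set.mem_Iic.1 h.2) (hmin hz)⟩⟩
  have hcl : IsCompact {lam | lam ∈ Set.Icc 0 (B / ρ) ∧
      IsMinOn (dualObjective p ρ V) (Set.Icc 0 (B / ρ)) lam} := by
    rw [hset]
    exact isCompact_Icc.of_isClosed_subset
      (hc.preimage_isClosed_of_isClosed isClosed_Icc isClosed_Iic) Set.inter_subset_left
  exact hcl.sInf_mem ⟨x, hx, hmin⟩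

/-- With `V` centered at its minimum, optimality of `0` reads `0 ≤ x * (ρ + log Z)` for `x > 0`,
where `Z` is the moment at `x`. So `Z ≥ exp (-ρ)`, and `x` tends to `0`. -/
theorem exp_neg_le_sublevelProb {p : S → ℝ} (hp : p ∈ stdSimplex ℝ S) {ρ : ℝ} {V : S → ℝ}
    (h : ∀ lam, 0 ≤ lam → dualObjective p ρ V 0 ≤ dualObjective p ρ V lam) :
    Real.exp (-ρ) ≤ sublevelProb p V (suppMin p V) := by
  refine ge_of_tendsto (tendsto_expMoment_suppMin hp V) ?_
  filter_upwards [self_mem_nhdsWithin] with x hx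
  have hx : 0 < x := hx
  have h1 := h x hx.le
  rw [dualObjective_zero, dualObjective_eq hp ρ V (suppMin p V) hx] at h1
  have h2 : 0 ≤ x * (ρ + Real.log (expMoment p V (suppMin p V) x)) := by linarith
  have h3 := nonneg_of_mul_nonneg_right h2 hx
  rw [← Real.le_log_iff_exp_le (expMoment_pos hp V _ x)]
  linarith

/-- Conditioning on the minimizers of `V` stays within the KL ball if they have probability at
least `exp (-ρ)`. -/
theorem exists_mem_klBall_sum_eq_suppMin {p : S → ℝ} (hp : p ∈ stdSimplex ℝ S) {ρ : ℝ} {V : S → ℝ}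
    (h : Real.exp (-ρ) ≤ sublevelProb p V (suppMin p V)) :
    ∃ q ∈ klBall p ρ, ∑ s, q s * V s = suppMin p V := by
  have hm := sublevelProb_suppMin_pos hp V
  set m := suppMin p V with hmdef
  set w := sublevelProb p V m with hw
  have hsum : ∑ s, (if V s ≤ m then p s / w else 0) = 1 := by
    rw [← Finset.sum_filter, ← Finset.sum_div]
    exact div_self hm.ne'
  refine ⟨fun s => if V s ≤ m then p s / w else 0, mem_klBall_iff.2 ⟨⟨fun s => ?_, hsum⟩,
    fun s hs => by simp [hs], ?_⟩, ?_⟩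
  · dsimp only
    split_ifs
    exacts [div_nonneg (hp.1 s) hm.le, le_rfl]
  · have h1 : ∀ s, (if V s ≤ m then p s / w else 0) *
        Real.log ((if V s ≤ m then p s / w else 0) / p s) =
        (if V s ≤ m then p s / w else 0) * -Real.log w := by
      intro s
      split_ifs with h2
      · rcases (hp.1 s).eq_or_lt with h0 | h0
        · simp [← h0]
        · rw [← Real.log_inv]
          congr 2
          field_simp
      · simp
    simp only [h1]
    rw [← Finset.sum_mul, hsum, one_mul]
    have := (Real.le_log_iff_exp_le hm).2 h
    linarith
  · have h1 : ∀ s, (if V s ≤ m then p s / w else 0) * V s =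
        (if V s ≤ m then p s / w else 0) * m := by
      intro s
      split_ifs with h2
      · rcases (hp.1 s).eq_or_lt with h0 | h0
        · simp [← h0]
        · rw [le_antisymm h2 (suppMin_le V h0)]
      · simp
    simp only [h1]
    rw [← Finset.sum_mul, hsum, one_mul]

/-- The primal optimizer is the conditional law on the minimizers of `V` when `lam = 0`, and the
exponentially tilted law when `lam > 0`. -/
theorem exists_mem_klBall_sum_eq {p : S → ℝ} (hp : p ∈ stdSimplex ℝ S) {ρ B : ℝ} (hρ : 0 < ρ)
    (hB : 0 ≤ B) {V : S → ℝ} (hV : ∀ s, V s ∈ Set.Icc 0 B) {lam : ℝ} (hlam : 0 ≤ lam)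
    (h : IsMinOn (dualObjective p ρ V) (Set.Icc 0 (B / ρ)) lam) :
    ∃ q ∈ klBall p ρ, ∑ s, q s * V s = -dualObjective p ρ V lam := by
  have hmin : ∀ x, 0 ≤ x → dualObjective p ρ V lam ≤ dualObjective p ρ V x :=
    fun x hx => dualObjective_le_of_isMinOn hp hρ hB hV h hx
  rcases hlam.eq_or_lt with rfl | hlam
  · rw [dualObjective_zero, neg_neg]
    exact exists_mem_klBall_sum_eq_suppMin hp (exp_neg_le_sublevelProb hp hmin)
  obtain ⟨q, hq, hqp, he⟩ := exists_neg_dualObjective_eq_lagrangian hp ρ V hlam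
  set A := ∑ s, q s * V s
  set K := ∑ s, q s * Real.log (q s / p s) with hK
  have hd : deriv (dualObjective p ρ V) lam = 0 := by
    refine IsLocalMin.deriv_eq_zero ?_
    filter_upwards [Ioi_mem_nhds hlam] with x hx using hmin x (le_of_lt hx)
  -- The Lagrangian of the fixed `q` dominates `-dualObjective` and touches it at `lam`, so this sum
  -- is minimal there. As the derivative of `dualObjective` vanishes, so does `K - ρ`: complementary
  -- slackness without a formula for the derivative.
  have hd' : HasDerivAt (fun x => A + x * (K - ρ) + dualObjective p ρ V x) (K - ρ) lam := by
    have h1 := (differentiableAt_dualObjective hp ρ V hlam).hasDerivAt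
    rw [hd] at h1
    have h2 := (((hasDerivAt_id lam).mul_const (K - ρ)).const_add A).add h1
    rw [one_mul, add_zero] at h2
    exact h2
  have h0 : K - ρ = 0 := by
    refine IsLocalMin.hasDerivAt_eq_zero (a := lam) ?_ hd'
    filter_upwards [Ioi_mem_nhds hlam] with x hx
    have := neg_dualObjective_le_lagrangian hp hq hqp ρ V (le_of_lt hx)
    linarith
  refine ⟨q, mem_klBall_iff.2 ⟨hq, hqp, ?_⟩, ?_⟩
  · linarith
  · rw [he, h0, mul_zero, add_zero]

/-- Strong duality for worst-case expectations over KL balls. -/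
theorem worstCase_eq_neg_dualObjective {p : S → ℝ} (hp : p ∈ stdSimplex ℝ S) {ρ B : ℝ} (hρ : 0 < ρ)
    (hB : 0 ≤ B) {V : S → ℝ} (hV : ∀ s, V s ∈ Set.Icc 0 B) {lam : ℝ} (hlam : 0 ≤ lam)
    (h : IsMinOn (dualObjective p ρ V) (Set.Icc 0 (B / ρ)) lam) :
    worstCase p ρ V = -dualObjective p ρ V lam := by
  obtain ⟨q, hq, he⟩ := exists_mem_klBall_sum_eq hp hρ hB hV hlam h
  refine IsLeast.csInf_eq ⟨⟨q, hq, he⟩, ?_⟩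
  rintro _ ⟨q', hq', rfl⟩
  exact neg_dualObjective_le_sum hp hq' V hlam

theorem neg_dualObjective_le_worstCase {p : S → ℝ} {ρ : ℝ} (hp : p ∈ stdSimplex ℝ S) (hρ : 0 ≤ ρ)
    (V : S → ℝ) {lam : ℝ} (hlam : 0 ≤ lam) : -dualObjective p ρ V lam ≤ worstCase p ρ V := by
  refine le_csInf ⟨_, p, self_mem_klBall hp hρ, rfl⟩ ?_
  rintro _ ⟨q', hq', rfl⟩
  exact neg_dualObjective_le_sum hp hq' V hlam

theorem exists_mem_klBall_sum_eq_worstCase {p : S → ℝ} (hp : p ∈ stdSimplex ℝ S) {ρ B : ℝ}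
    (hρ : 0 < ρ) (hB : 0 ≤ B) {V : S → ℝ} (hV : ∀ s, V s ∈ Set.Icc 0 B) :
    ∃ q ∈ klBall p ρ, ∑ s, q s * V s = worstCase p ρ V := by
  obtain ⟨h1, h2⟩ := exists_isMinOn_dualObjective hp hρ hB V
  rw [worstCase_eq_neg_dualObjective hp hρ hB hV h1.1 h2]
  exact exists_mem_klBall_sum_eq hp hρ hB hV h1.1 h2

theorem bddBelow_image_klBall (p : S → ℝ) (ρ : ℝ) (V : S → ℝ) :
    BddBelow ((fun q : S → ℝ => ∑ s, q s * V s) '' klBall p ρ) := by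
  refine ⟨-‖V‖, ?_⟩
  rintro _ ⟨q, hq, rfl⟩
  exact le_sum_mul_of_forall_le (mem_klBall_iff.1 hq).1
    fun s _ => (abs_le.1 (norm_le_pi_norm V s)).1

theorem worstCase_le_sum {p q : S → ℝ} {ρ : ℝ} (hq : q ∈ klBall p ρ) (V : S → ℝ) :
    worstCase p ρ V ≤ ∑ s, q s * V s :=
  csInf_le (bddBelow_image_klBall p ρ V) ⟨q, hq, rfl⟩

theorem le_worstCase {p : S → ℝ} {ρ : ℝ} (hp : p ∈ stdSimplex ℝ S) (hρ : 0 ≤ ρ) {V : S → ℝ} {c : ℝ}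
    (h : ∀ s, 0 < p s → c ≤ V s) : c ≤ worstCase p ρ V := by
  refine le_csInf ⟨_, p, self_mem_klBall hp hρ, rfl⟩ ?_
  rintro _ ⟨q, hq, rfl⟩
  obtain ⟨h1, h2, -⟩ := mem_klBall_iff.1 hq
  exact le_sum_mul_of_forall_le h1 fun s hs =>
    h s ((hp.1 s).lt_of_ne fun h0 => hs.ne' (h2 s h0.symm))

theorem worstCase_le {p : S → ℝ} {ρ : ℝ} (hp : p ∈ stdSimplex ℝ S) (hρ : 0 ≤ ρ) {V : S → ℝ} {c : ℝ}
    (h : ∀ s, V s ≤ c) : worstCase p ρ V ≤ c := by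
  refine (worstCase_le_sum (self_mem_klBall hp hρ) V).trans ?_
  calc ∑ s, p s * V s ≤ ∑ s, p s * c :=
        Finset.sum_le_sum fun s _ => mul_le_mul_of_nonneg_left (h s) (hp.1 s)
    _ = c := by rw [← Finset.sum_mul, hp.2, one_mul]

theorem worstCase_le_worstCase_add {p : S → ℝ} {ρ : ℝ} (hp : p ∈ stdSimplex ℝ S) (hρ : 0 ≤ ρ)
    {V W : S → ℝ} {c : ℝ} (h : ∀ s, V s ≤ W s + c) :
    worstCase p ρ V ≤ worstCase p ρ W + c := by
  rw [← sub_le_iff_le_add]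
  refine le_csInf ⟨_, p, self_mem_klBall hp hρ, rfl⟩ ?_
  rintro _ ⟨q, hq, rfl⟩
  rw [sub_le_iff_le_add]
  refine (worstCase_le_sum hq V).trans ?_
  have h1 := (mem_klBall_iff.1 hq).1
  calc ∑ s, q s * V s ≤ ∑ s, q s * (W s + c) :=
        Finset.sum_le_sum fun s _ => mul_le_mul_of_nonneg_left (h s) (h1.1 s)
    _ = _ := by simp only [mul_add, Finset.sum_add_distrib]; rw [← Finset.sum_mul, h1.2, one_mul]

end KL

/-! ### Trajectories and the Bellman equation for a fixed model. -/

section Paths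

variable {S A : Type*} {H : ℕ}

theorem filter_castSucc_le_castSucc (h : Fin H) :
    ({t : Fin H | h.castSucc ≤ t.castSucc} : Finset (Fin H)) =
      insert h ({t : Fin H | h.succ ≤ t.castSucc} : Finset (Fin H)) := by
  ext t
  simp only [Finset.mem_filter, Finset.mem_univ, true_and, Finset.mem_insert, Fin.le_def,
    Fin.val_castSucc, Fin.val_succ, Fin.ext_iff]
  omega

theorem notMem_filter_succ_le_castSucc (h : Fin H) :
    h ∉ ({t : Fin H | h.succ ≤ t.castSucc} : Finset (Fin H)) := by
  simp [Fin.le_def]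

theorem glue_castSucc_of_le (h : Fin H) (s : S) (y : Fin (H + 1) → S) {t : Fin (H + 1)}
    (ht : h.succ ≤ t) : (if t ≤ h.castSucc then s else y t) = y t := by
  rw [if_neg]
  simp only [Fin.le_def, Fin.val_castSucc, Fin.val_succ] at *
  omega

/-- The probability of the trajectory `x` from time `k` on. -/
def pathProb (P : Fin H → S → A → S → ℝ) (π : Policy S A H) (k : Fin (H + 1))
    (x : Fin (H + 1) → S) : ℝ :=
  ∏ t : Fin H with k ≤ t.castSucc, P t (x t.castSucc) (π t (x t.castSucc)) (x t.succ)

/-- The total reward of the trajectory `x` from time `k` on. -/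
def pathReward (r : Fin H → S → A → ℝ) (π : Policy S A H) (k : Fin (H + 1))
    (x : Fin (H + 1) → S) : ℝ :=
  ∑ t : Fin H with k ≤ t.castSucc, r t (x t.castSucc) (π t (x t.castSucc))

theorem pathProb_castSucc (P : Fin H → S → A → S → ℝ) (π : Policy S A H) (h : Fin H) (s s' : S)
    {y : Fin (H + 1) → S} (hy : ∀ t, t ≤ h.succ → y t = s') :
    pathProb P π h.castSucc (fun t => if t ≤ h.castSucc then s else y t) =
      P h s (π h s) s' * pathProb P π h.succ y := by
  rw [pathProb, filter_castSucc_le_castSucc,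
    Finset.prod_insert (notMem_filter_succ_le_castSucc h)]
  congr 1
  · rw [if_pos le_rfl, glue_castSucc_of_le h s y le_rfl, hy _ le_rfl]
  · refine Finset.prod_congr rfl fun t ht => ?_
    have ht : h.succ ≤ t.castSucc := by simpa using ht
    rw [glue_castSucc_of_le h s y ht,
      glue_castSucc_of_le h s y (ht.trans (Fin.castSucc_lt_succ (i := t)).le)]

theorem pathReward_castSucc (r : Fin H → S → A → ℝ) (π : Policy S A H) (h : Fin H) (s : S)
    (y : Fin (H + 1) → S) :
    pathReward r π h.castSucc (fun t => if t ≤ h.castSucc then s else y t) =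
      r h s (π h s) + pathReward r π h.succ y := by
  rw [pathReward, filter_castSucc_le_castSucc,
    Finset.sum_insert (notMem_filter_succ_le_castSucc h)]
  congr 1
  · rw [if_pos le_rfl]
  · refine Finset.sum_congr rfl fun t ht => ?_
    have ht : h.succ ≤ t.castSucc := by simpa using ht
    rw [glue_castSucc_of_le h s y ht]

end Paths

section Values

variable {S A : Type*} [Fintype S] [DecidableEq S] {H : ℕ}

/-- A trajectory frozen at `s` up to time `h` amounts to its state `s'` at time `h + 1` and its
continuation; refreezing the past at `s'`, respectively `s`, gives mutually inverse bijections. -/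
theorem sum_paths_castSucc (h : Fin H) (s : S) (f : (Fin (H + 1) → S) → ℝ) :
    ∑ x : Fin (H + 1) → S with ∀ t, t ≤ h.castSucc → x t = s, f x =
      ∑ s', ∑ y : Fin (H + 1) → S with ∀ t, t ≤ h.succ → y t = s',
        f (fun t => if t ≤ h.castSucc then s else y t) := by
  rw [← Finset.sum_fiberwise _ (fun x : Fin (H + 1) → S => x h.succ)]
  refine Finset.sum_congr rfl fun s' _ => ?_
  refine Finset.sum_bij' (fun x _ t => if t ≤ h.succ then s' else x t)
    (fun y _ t => if t ≤ h.castSucc then s else y t) ?_ ?_ ?_ ?_ ?_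
  · intro x hx
    simp only [Finset.mem_filter, Finset.mem_univ, true_and]
    intro t ht
    rw [if_pos ht]
  · intro y hy
    simp only [Finset.mem_filter, Finset.mem_univ, true_and] at hy ⊢
    refine ⟨fun t ht => if_pos ht, ?_⟩
    rw [if_neg (by simp [Fin.le_def]), hy _ le_rfl]
  · intro x hx
    simp only [Finset.mem_filter, Finset.mem_univ, true_and] at hx
    funext t
    dsimp only
    split_ifs with h1 h2
    · exact (hx.1 t h1).symm
    · have : t = h.succ := by
        simp only [Fin.le_def, Fin.val_castSucc, Fin.val_succ, Fin.ext_iff] at *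
        omega
      rw [this, hx.2]
    · rfl
  · intro y hy
    simp only [Finset.mem_filter, Finset.mem_univ, true_and] at hy
    funext t
    dsimp only
    split_ifs with h1 h2
    · exact (hy t h1).symm
    · simp only [Fin.le_def, Fin.val_castSucc, Fin.val_succ] at *
      omega
    · rfl
  · intro x hx
    simp only [Finset.mem_filter, Finset.mem_univ, true_and] at hx
    congr 1
    funext t
    dsimp only
    split_ifs with h1 h2
    · exact hx.1 t h1
    · have : t = h.succ := by
        simp only [Fin.le_def, Fin.val_castSucc, Fin.val_succ, Fin.ext_iff] at *
        omega
      rw [this, hx.2]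
    · rfl

theorem filter_last_le_castSucc :
    ({t : Fin H | Fin.last H ≤ t.castSucc} : Finset (Fin H)) = ∅ := by
  ext t
  simp [Fin.le_def]

theorem sum_pathProb {P : Fin H → S → A → S → ℝ} (hP : ∀ h s a, P h s a ∈ stdSimplex ℝ S)
    (π : Policy S A H) (k : Fin (H + 1)) : ∀ s,
    ∑ x : Fin (H + 1) → S with ∀ t, t ≤ k → x t = s, pathProb P π k x = 1 := by
  induction k using Fin.reverseInduction with
  | last =>
    intro s
    have : ({x : Fin (H + 1) → S | ∀ t, t ≤ Fin.last H → x t = s} : Finset _) = {fun _ => s} := by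
      ext x
      simp [Fin.le_last, funext_iff]
    rw [this, Finset.sum_singleton, pathProb, filter_last_le_castSucc, Finset.prod_empty]
  | cast h ih =>
    intro s
    rw [sum_paths_castSucc, ← (hP h s (π h s)).2]
    refine Finset.sum_congr rfl fun s' _ => ?_
    rw [← mul_one (P h s (π h s) s'), ← ih s', Finset.mul_sum]
    refine Finset.sum_congr rfl fun y hy => ?_
    exact pathProb_castSucc P π h s s' (by simpa using hy)

theorem policyValue_last (r : Fin H → S → A → ℝ) (P : Fin H → S → A → S → ℝ) (π : Policy S A H)
    (s : S) : policyValue r P π (Fin.last H) s = 0 := by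
  refine Finset.sum_eq_zero fun x _ => ?_
  rw [filter_last_le_castSucc, Finset.sum_empty, mul_zero]

/-- The Bellman equation for a fixed policy and a fixed transition model. -/
theorem policyValue_castSucc (r : Fin H → S → A → ℝ) {P : Fin H → S → A → S → ℝ}
    (hP : ∀ h s a, P h s a ∈ stdSimplex ℝ S) (π : Policy S A H) (h : Fin H) (s : S) :
    policyValue r P π h.castSucc s =
      r h s (π h s) + ∑ s', P h s (π h s) s' * policyValue r P π h.succ s' := by
  have h1 : policyValue r P π h.castSucc s =
      ∑ x : Fin (H + 1) → S with ∀ t, t ≤ h.castSucc → x t = s,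
        pathProb P π h.castSucc x * pathReward r π h.castSucc x := rfl
  rw [h1, sum_paths_castSucc]
  have h2 : r h s (π h s) = ∑ s', P h s (π h s) s' * r h s (π h s) := by
    rw [← Finset.sum_mul, (hP h s (π h s)).2, one_mul]
  rw [h2, ← Finset.sum_add_distrib]
  refine Finset.sum_congr rfl fun s' _ => ?_
  have h3 : policyValue r P π h.succ s' =
      ∑ x : Fin (H + 1) → S with ∀ t, t ≤ h.succ → x t = s',
        pathProb P π h.succ x * pathReward r π h.succ x := rfl
  rw [h3, ← mul_add, ← one_mul (r h s (π h s)), ← sum_pathProb hP π h.succ s', Finset.sum_mul,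
    ← Finset.sum_add_distrib, Finset.mul_sum]
  refine Finset.sum_congr rfl fun y hy => ?_
  rw [pathProb_castSucc P π h s s' (by simpa using hy), pathReward_castSucc]
  ring

end Values

/-! ### Robust Bellman recursions. -/

section Bellman

variable {S A : Type*} [Fintype S] {H : ℕ}

/-- The robust values of the policy `π`, computed by the robust Bellman recursion. -/
def bellmanValue (M : MDP S A H) (ρ : ℝ) (π : Policy S A H) : Fin (H + 1) → S → ℝ :=
  Fin.reverseInduction (motive := fun _ => S → ℝ) (fun _ => 0)
    (fun h V s => M.reward h s (π h s) + worstCase (M.trans h s (π h s)) ρ V)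

theorem bellmanValue_last (M : MDP S A H) (ρ : ℝ) (π : Policy S A H) (s : S) :
    bellmanValue M ρ π (Fin.last H) s = 0 := by
  simp [bellmanValue]

theorem bellmanValue_castSucc (M : MDP S A H) (ρ : ℝ) (π : Policy S A H) (h : Fin H) (s : S) :
    bellmanValue M ρ π h.castSucc s =
      M.reward h s (π h s) + worstCase (M.trans h s (π h s)) ρ (bellmanValue M ρ π h.succ) := by
  simp [bellmanValue]

/-- The values of dynamic programming with the KL balls of radius `ρ` around `P`. -/
def greedyValue (r : Fin H → S → A → ℝ) (P : Fin H → S → A → S → ℝ) (ρ : ℝ) :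
    Fin (H + 1) → S → ℝ :=
  Fin.reverseInduction (motive := fun _ => S → ℝ) (fun _ => 0)
    (fun h V s => ⨆ a : A, (r h s a + worstCase (P h s a) ρ V))

theorem greedyValue_last (r : Fin H → S → A → ℝ) (P : Fin H → S → A → S → ℝ) (ρ : ℝ) (s : S) :
    greedyValue r P ρ (Fin.last H) s = 0 := by
  simp [greedyValue]

theorem greedyValue_castSucc (r : Fin H → S → A → ℝ) (P : Fin H → S → A → S → ℝ) (ρ : ℝ)
    (h : Fin H) (s : S) : greedyValue r P ρ h.castSucc s =
      ⨆ a : A, (r h s a + worstCase (P h s a) ρ (greedyValue r P ρ h.succ)) := by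
  simp [greedyValue]

theorem rpvlValue_eq_greedyValue [DecidableEq S] {N : ℕ} (r : Fin H → S → A → ℝ) (ρ : ℝ)
    (D : Dataset S A H N) :
    rpvlValue r ρ D = greedyValue r (empirical D) ρ := rfl

theorem greedyValue_mem_Icc [Finite A] [Nonempty A] {r : Fin H → S → A → ℝ}
    (hr : ∀ h s a, r h s a ∈ Set.Icc (0 : ℝ) 1) {P : Fin H → S → A → S → ℝ}
    (hP : ∀ h s a, P h s a ∈ stdSimplex ℝ S) {ρ : ℝ} (hρ : 0 ≤ ρ) (k : Fin (H + 1)) :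
    ∀ s, greedyValue r P ρ k s ∈ Set.Icc (0 : ℝ) (H - k : ℝ) := by
  induction k using Fin.reverseInduction with
  | last => intro s; simp [greedyValue_last]
  | cast h ih =>
    intro s
    rw [greedyValue_castSucc]
    simp only [Fin.val_succ, Nat.cast_add, Nat.cast_one, Fin.val_castSucc] at *
    have h1 : ∀ a, 0 ≤ r h s a + worstCase (P h s a) ρ (greedyValue r P ρ h.succ) := fun a =>
      add_nonneg (hr h s a).1 (le_worstCase (hP h s a) hρ fun s _ => (ih s).1)
    have h2 : ∀ a, r h s a + worstCase (P h s a) ρ (greedyValue r P ρ h.succ) ≤ H - h := fun a => by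
      have := worstCase_le (hP h s a) hρ fun s => (ih s).2
      linarith [(hr h s a).2]
    obtain ⟨a⟩ := ‹Nonempty A›
    exact ⟨le_ciSup_of_le (Set.finite_range _).bddAbove a (h1 a), ciSup_le h2⟩

theorem greedyValue_mem_Icc_horizon [Finite A] [Nonempty A] {r : Fin H → S → A → ℝ}
    (hr : ∀ h s a, r h s a ∈ Set.Icc (0 : ℝ) 1) {P : Fin H → S → A → S → ℝ}
    (hP : ∀ h s a, P h s a ∈ stdSimplex ℝ S) {ρ : ℝ} (hρ : 0 ≤ ρ) (k : Fin (H + 1)) (s : S) :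
    greedyValue r P ρ k s ∈ Set.Icc (0 : ℝ) H := by
  obtain ⟨h1, h2⟩ := greedyValue_mem_Icc hr hP hρ k s
  exact ⟨h1, h2.trans (sub_le_self _ (Nat.cast_nonneg _))⟩

theorem bellmanValue_mem_Icc (M : MDP S A H) {ρ : ℝ} (hρ : 0 ≤ ρ) (π : Policy S A H)
    (k : Fin (H + 1)) : ∀ s, bellmanValue M ρ π k s ∈ Set.Icc (0 : ℝ) (H - k : ℝ) := by
  induction k using Fin.reverseInduction with
  | last => intro s; simp [bellmanValue_last]
  | cast h ih =>
    intro s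
    rw [bellmanValue_castSucc]
    simp only [Fin.val_succ, Nat.cast_add, Nat.cast_one, Fin.val_castSucc] at *
    have hp := M.trans_mem h s (π h s)
    have hr := M.reward_mem h s (π h s)
    have := worstCase_le hp hρ fun s => (ih s).2
    exact ⟨add_nonneg hr.1 (le_worstCase hp hρ fun s _ => (ih s).1), by linarith [hr.2]⟩

/-- The robust Bellman equation: the robust value is given by the recursion. -/
theorem robustValue_eq_bellmanValue [DecidableEq S] (M : MDP S A H) {ρ : ℝ} (hρ : 0 < ρ) (π : Policy S A H)
    (k : Fin (H + 1)) (s : S) : M.robustValue ρ π k s = bellmanValue M ρ π k s := by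
  have hV : ∀ (k : Fin (H + 1)) s, bellmanValue M ρ π k s ∈ Set.Icc (0 : ℝ) H := fun k s =>
    ⟨(bellmanValue_mem_Icc M hρ.le π k s).1, (bellmanValue_mem_Icc M hρ.le π k s).2.trans
      (sub_le_self _ (Nat.cast_nonneg _))⟩
  have hle : ∀ Q ∈ M.uncertaintySet ρ, ∀ k s,
      bellmanValue M ρ π k s ≤ policyValue M.reward Q π k s := by
    intro Q hQ k
    induction k using Fin.reverseInduction with
    | last => intro s; rw [bellmanValue_last, policyValue_last]
    | cast h ih =>
      intro s
      have hs : ∀ h s a, Q h s a ∈ stdSimplex ℝ S := fun h s a => (mem_klBall_iff.1 (hQ h s a)).1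
      rw [bellmanValue_castSucc, policyValue_castSucc _ hs]
      refine add_le_add le_rfl ((worstCase_le_sum (hQ h s (π h s)) _).trans ?_)
      exact Finset.sum_le_sum fun s' _ => mul_le_mul_of_nonneg_left (ih s') ((hs h s _).1 s')
  -- Rectangularity: the minimizers at the separate `(h, s, a)` form one admissible model, which
  -- attains the recursion at all times and states.
  choose Q hQ hQe using fun h s a =>
    exists_mem_klBall_sum_eq_worstCase (M.trans_mem h s a) hρ (Nat.cast_nonneg H) (hV h.succ)
  have heq : ∀ k s, policyValue M.reward Q π k s = bellmanValue M ρ π k s := by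
    intro k
    induction k using Fin.reverseInduction with
    | last => intro s; rw [bellmanValue_last, policyValue_last]
    | cast h ih =>
      intro s
      rw [bellmanValue_castSucc, policyValue_castSucc _
        (fun h s a => (mem_klBall_iff.1 (hQ h s a)).1), ← hQe h s (π h s)]
      simp only [ih]
  have : IsLeast (Set.range fun Q : M.uncertaintySet ρ => policyValue M.reward Q.1 π k s)
      (bellmanValue M ρ π k s) :=
    ⟨⟨⟨Q, hQ⟩, heq k s⟩, by rintro _ ⟨Q, rfl⟩; exact hle Q.1 Q.2 k s⟩
  exact this.csInf_eq

/-- Monotonicity of the worst case bounds every policy by the recursion, and a single greedy policy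
attains it everywhere. -/
theorem optRobustValue_eq_greedyValue [DecidableEq S] [Finite A] [Nonempty A] (M : MDP S A H)
    {ρ : ℝ} (hρ : 0 < ρ) (k : Fin (H + 1)) (s : S) :
    M.optRobustValue ρ k s = greedyValue M.reward M.trans ρ k s := by
  have hle : ∀ π k s, bellmanValue M ρ π k s ≤ greedyValue M.reward M.trans ρ k s := by
    intro π k
    induction k using Fin.reverseInduction with
    | last => intro s; rw [bellmanValue_last, greedyValue_last]
    | cast h ih =>
      intro s
      rw [bellmanValue_castSucc, greedyValue_castSucc]
      refine le_ciSup_of_le (Set.finite_range _).bddAbove (π h s) (add_le_add le_rfl ?_)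
      simpa using worstCase_le_worstCase_add (M.trans_mem h s (π h s)) hρ.le (c := 0)
        (fun s => by simpa using ih s)
  choose π hπ using fun (h : Fin H) (s : S) => exists_eq_ciSup_of_finite (f := fun a : A =>
    M.reward h s a + worstCase (M.trans h s a) ρ (greedyValue M.reward M.trans ρ h.succ))
  have heq : ∀ k, bellmanValue M ρ π k = greedyValue M.reward M.trans ρ k := by
    intro k
    induction k using Fin.reverseInduction with
    | last => funext s; rw [bellmanValue_last, greedyValue_last]
    | cast h ih =>
      funext s
      rw [bellmanValue_castSucc, greedyValue_castSucc, ← hπ h s, ih]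
  have : IsGreatest (Set.range fun π : Policy S A H => M.robustValue ρ π k s)
      (greedyValue M.reward M.trans ρ k s) := by
    refine ⟨⟨π, ?_⟩, ?_⟩
    · dsimp only
      rw [robustValue_eq_bellmanValue M hρ, heq]
    · rintro _ ⟨π, rfl⟩
      dsimp only
      rw [robustValue_eq_bellmanValue M hρ]
      exact hle π k s
  exact this.csSup_eq

end Bellman

/-! ### Stability of worst-case expectations. -/

section Perturbation

variable {S : Type*} [Fintype S]

/-- The distribution functions of `V` under `p` and `q` differ by at most `η`. -/
def SublevelClose (p q V : S → ℝ) (η : ℝ) : Prop :=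
  ∀ s, |sublevelProb q V (V s) - sublevelProb p V (V s)| ≤ η

/-- For antitone `φ`, a nonempty superlevel set of `φ ∘ V` is a sublevel set of `V` at an attained
level. This is why `SublevelClose` tests only levels in the range of `V`. -/
theorem SublevelClose.abs_sum_filter_le {p q V : S → ℝ} {η : ℝ} (h : SublevelClose p q V η)
    (hη : 0 ≤ η) {φ : ℝ → ℝ} (hφ : Antitone φ) (t : ℝ) :
    |∑ s with t ≤ φ (V s), (q s - p s)| ≤ η := by
  rcases Finset.eq_empty_or_nonempty ({s | t ≤ φ (V s)} : Finset S) with h0 | h0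
  · rw [h0, Finset.sum_empty, abs_zero]
    exact hη
  · obtain ⟨m, hm, hmax⟩ := Finset.exists_max_image _ V h0
    have he : ({s | t ≤ φ (V s)} : Finset S) = ({s | V s ≤ V m} : Finset S) := by
      ext s
      simp only [Finset.mem_filter, Finset.mem_univ, true_and] at hm hmax ⊢
      exact ⟨hmax s, fun hs => hm.trans (hφ hs)⟩
    rw [he, Finset.sum_sub_distrib]
    exact h m

/-- Expectations of antitone functions of `V` with values in `[0, 1]` differ by at most `η`. -/
theorem SublevelClose.abs_sum_sub_le {p q V : S → ℝ} {η : ℝ} (h : SublevelClose p q V η)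
    (hη : 0 ≤ η) {φ : ℝ → ℝ} (hφ : Antitone φ) (hφ' : ∀ v, φ v ∈ Set.Icc (0 : ℝ) 1) :
    |∑ s, q s * φ (V s) - ∑ s, p s * φ (V s)| ≤ η := by
  -- Layer cake: each value in `[0, 1]` is an integral of indicators, so the difference of
  -- expectations averages differences of superlevel probabilities.
  have h1 : ∀ c ∈ Set.Icc (0 : ℝ) 1,
      ∫ t in (0 : ℝ)..1, Set.indicator {t | t ≤ c} (fun _ => 1) t = c := fun c hc => by
      rw [intervalIntegral.integral_indicator hc]
      simp
  have hi : ∀ c : ℝ,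
      IntervalIntegrable (Set.indicator {t | t ≤ c} (fun _ => (1 : ℝ))) volume 0 1 := by
    intro c
    refine Antitone.intervalIntegrable fun x y hxy => ?_
    by_cases hy : y ≤ c
    · rw [Set.indicator_of_mem (show y ∈ {t | t ≤ c} from hy),
        Set.indicator_of_mem (show x ∈ {t | t ≤ c} from hxy.trans hy)]
    · rw [Set.indicator_of_notMem (show y ∉ {t | t ≤ c} from hy)]
      exact Set.indicator_nonneg (fun _ _ => zero_le_one) x
  have h2 : ∑ s, q s * φ (V s) - ∑ s, p s * φ (V s) = ∫ t in (0 : ℝ)..1,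
      ∑ s, (q s - p s) * Set.indicator {t | t ≤ φ (V s)} (fun _ => 1) t := by
    rw [intervalIntegral.integral_finsetSum fun s _ => (hi _).const_mul _,
      ← Finset.sum_sub_distrib]
    refine Finset.sum_congr rfl fun s _ => ?_
    rw [intervalIntegral.integral_const_mul, h1 _ (hφ' _)]
    ring
  rw [h2]
  have h3 := intervalIntegral.norm_integral_le_of_norm_le_const (a := 0) (b := 1) (C := η)
    (f := fun t : ℝ => ∑ s, (q s - p s) * Set.indicator {t | t ≤ φ (V s)} (fun _ => (1 : ℝ)) t)
    (fun t _ => by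
      have : ∑ s, (q s - p s) * Set.indicator {t | t ≤ φ (V s)} (fun _ => (1 : ℝ)) t =
          ∑ s with t ≤ φ (V s), (q s - p s) := by
        rw [Finset.sum_filter]
        refine Finset.sum_congr rfl fun s _ => ?_
        by_cases ht : t ≤ φ (V s)
        · rw [if_pos ht, Set.indicator_of_mem (show t ∈ {t | t ≤ φ (V s)} from ht), mul_one]
        · rw [if_neg ht, Set.indicator_of_notMem (show t ∉ {t | t ≤ φ (V s)} from ht), mul_zero]
      rw [this]
      exact h.abs_sum_filter_le hη hφ t)
  simpa using h3

/-- The logarithm is Lipschitz with constant `1 / β` above `β`. The center `c` stays free: `0`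
serves for dual variables bounded below, the support minimum for a vanishing one. -/
theorem abs_dualObjective_sub_le {p q : S → ℝ} (hp : p ∈ stdSimplex ℝ S) (hq : q ∈ stdSimplex ℝ S)
    (ρ : ℝ) (V : S → ℝ) (c : ℝ) {lam β η : ℝ} (hlam : 0 < lam) (hβ : 0 < β)
    (hβp : β ≤ expMoment p V c lam) (hβq : β ≤ expMoment q V c lam)
    (h : |expMoment q V c lam - expMoment p V c lam| ≤ η) :
    |dualObjective q ρ V lam - dualObjective p ρ V lam| ≤ lam * (η / β) := by
  have aux : ∀ x y : ℝ, β ≤ x → β ≤ y → |x - y| ≤ η → Real.log x - Real.log y ≤ η / β := by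
    intro x y hx hy hxy
    have hx0 := hβ.trans_le hx
    have hy0 := hβ.trans_le hy
    rw [← Real.log_div hx0.ne' hy0.ne']
    refine (Real.log_le_sub_one_of_pos (div_pos hx0 hy0)).trans ?_
    rw [div_sub_one hy0.ne']
    exact div_le_div₀ ((abs_nonneg _).trans hxy) ((le_abs_self _).trans hxy) hβ hy
  rw [dualObjective_eq hp ρ V c hlam, dualObjective_eq hq ρ V c hlam]
  have h1 := aux _ _ hβq hβp h
  have h2 := aux _ _ hβp hβq (by rwa [abs_sub_comm])
  have h3 : lam * ρ - c + lam * Real.log (expMoment q V c lam) -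
      (lam * ρ - c + lam * Real.log (expMoment p V c lam)) =
      lam * (Real.log (expMoment q V c lam) - Real.log (expMoment p V c lam)) := by ring
  rw [h3, abs_mul, abs_of_pos hlam]
  exact mul_le_mul_of_nonneg_left (abs_le.2 ⟨by linarith, h1⟩) hlam.le

theorem SublevelClose.abs_dualObjective_sub_le {p q : S → ℝ} (hp : p ∈ stdSimplex ℝ S)
    (hq : q ∈ stdSimplex ℝ S) {ρ B : ℝ} (hB : 0 ≤ B) {V : S → ℝ}
    (hV : ∀ s, V s ∈ Set.Icc 0 B) {η : ℝ} (hη : 0 ≤ η) (h : SublevelClose p q V η) {lam₀ lam : ℝ}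
    (hlam₀ : 0 < lam₀) (hlam : lam ∈ Set.Icc lam₀ (B / ρ)) :
    |dualObjective q ρ V lam - dualObjective p ρ V lam| ≤ B / ρ * Real.exp (B / lam₀) * η := by
  have hlam0 := hlam₀.trans_le hlam.1
  have hβ : ∀ {p : S → ℝ}, p ∈ stdSimplex ℝ S → Real.exp (-(B / lam₀)) ≤ expMoment p V 0 lam := by
    intro p hp
    refine le_sum_mul_of_forall_le hp fun s _ => Real.exp_le_exp.2 ?_
    rw [neg_div, sub_zero, neg_le_neg_iff]
    exact div_le_div₀ hB (hV s).2 hlam₀ hlam.1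
  -- Truncation at `0` keeps the function in `[0, 1]` on the whole line and changes nothing on the
  -- values of `V`.
  have hφ : Antitone fun v : ℝ => Real.exp (-(max v 0) / lam) := fun x y hxy =>
    Real.exp_le_exp.2 (div_le_div_of_nonneg_right (neg_le_neg (max_le_max hxy le_rfl)) hlam0.le)
  have h1 := h.abs_sum_sub_le hη hφ fun v => ⟨(Real.exp_pos _).le, Real.exp_le_one_iff.2
    (div_nonpos_of_nonpos_of_nonneg (neg_nonpos.2 (le_max_right _ _)) hlam0.le)⟩
  have h2 : ∀ p : S → ℝ, ∑ s, p s * Real.exp (-(max (V s) 0) / lam) = expMoment p V 0 lam :=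
    fun p => Finset.sum_congr rfl fun s _ => by rw [max_eq_left (hV s).1, sub_zero]
  rw [h2, h2] at h1
  refine (RobustRL.abs_dualObjective_sub_le hp hq ρ V 0 hlam0 (Real.exp_pos _) (hβ hp) (hβ hq)
    h1).trans ?_
  rw [Real.exp_neg, div_inv_eq_mul, mul_assoc, mul_comm η]
  exact mul_le_mul_of_nonneg_right hlam.2 (by positivity)

/-- Each minimizer is tested in the other problem; both lie in `[lam₀, B / ρ]`, where the objectives
are uniformly close. -/
theorem SublevelClose.abs_worstCase_sub_le {p q : S → ℝ} (hp : p ∈ stdSimplex ℝ S)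
    (hq : q ∈ stdSimplex ℝ S) {ρ B : ℝ} (hρ : 0 < ρ) (hB : 0 ≤ B) {V : S → ℝ}
    (hV : ∀ s, V s ∈ Set.Icc 0 B) {η : ℝ} (hη : 0 ≤ η) (h : SublevelClose p q V η) {lam₀ : ℝ}
    (hlam₀ : 0 < lam₀) (h1 : lam₀ ≤ dualOptimizer p ρ B V) (h2 : lam₀ ≤ dualOptimizer q ρ B V) :
    |worstCase p ρ V - worstCase q ρ V| ≤ B / ρ * Real.exp (B / lam₀) * η := by
  obtain ⟨hx, hxm⟩ := exists_isMinOn_dualObjective hp hρ hB V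
  obtain ⟨hy, hym⟩ := exists_isMinOn_dualObjective hq hρ hB V
  rw [worstCase_eq_neg_dualObjective hp hρ hB hV hx.1 hxm,
    worstCase_eq_neg_dualObjective hq hρ hB hV hy.1 hym]
  have e1 := abs_le.1 (h.abs_dualObjective_sub_le hp hq hB hV hη hlam₀ ⟨h1, hx.2⟩)
  have e2 := abs_le.1 (h.abs_dualObjective_sub_le hp hq hB hV hη hlam₀ ⟨h2, hy.2⟩)
  have e3 := isMinOn_iff.1 hxm _ hy
  have e4 := isMinOn_iff.1 hym _ hx
  exact abs_le.2 ⟨by linarith [e2.1], by linarith [e1.2]⟩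

theorem exists_le_dualOptimizer_of_sublevelClose {p : S → ℝ} (hp : p ∈ stdSimplex ℝ S) {ρ B : ℝ}
    (hρ : 0 < ρ) (hB : 0 < B) {V : S → ℝ} (hV : ∀ s, V s ∈ Set.Icc 0 B) {lam₀ : ℝ}
    (hlam₀ : 0 < lam₀) (hlt : lam₀ < dualOptimizer p ρ B V) :
    ∃ η₀ > 0, ∀ q ∈ stdSimplex ℝ S, ∀ η, 0 ≤ η → η ≤ η₀ → SublevelClose p q V η →
      lam₀ ≤ dualOptimizer q ρ B V := by
  obtain ⟨hx, hxm⟩ := exists_isMinOn_dualObjective hp hρ hB.le V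
  have hmem : lam₀ ∈ Set.Icc 0 (B / ρ) := ⟨hlam₀.le, hlt.le.trans hx.2⟩
  -- `dualOptimizer` is the least minimizer, so `lam₀`, to its left, is not one.
  have hgap : dualObjective p ρ V (dualOptimizer p ρ B V) < dualObjective p ρ V lam₀ := by
    by_contra! hcon
    refine hlt.not_ge (csInf_le ⟨0, fun y hy => hy.1.1⟩ ⟨hmem, fun z hz => ?_⟩)
    exact hcon.trans (hxm hz)
  set x := dualOptimizer p ρ B V
  have hC : 0 < B / ρ * Real.exp (B / lam₀) := by positivity
  set C := B / ρ * Real.exp (B / lam₀)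
  refine ⟨(dualObjective p ρ V lam₀ - dualObjective p ρ V x) / (4 * C),
    div_pos (by linarith) (by linarith), fun q hq η hη hη₀ hcl => ?_⟩
  have h1 := abs_le.1
    (hcl.abs_dualObjective_sub_le hp hq hB.le hV hη hlam₀ ⟨le_rfl, hmem.2⟩)
  have h2 := abs_le.1
    (hcl.abs_dualObjective_sub_le hp hq hB.le hV hη hlam₀ ⟨hlt.le, hx.2⟩)
  rw [le_div_iff₀ (by linarith)] at hη₀
  have h3 : dualObjective q ρ V x < dualObjective q ρ V lam₀ := by
    linarith [h1.1, h2.2]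
  obtain ⟨hy, hym⟩ := exists_isMinOn_dualObjective hq hρ hB.le V
  set y := dualOptimizer q ρ B V
  by_contra! hylt
  have h4 := isMinOn_iff.1 hym x hx
  -- Convexity by a supporting line: the Lagrangian of `q'` is affine in the dual variable,
  -- dominates `-dualObjective q ρ V` and touches it at `lam₀`. Since `y < lam₀ < x`, whatever the
  -- sign of its slope `K`, at `y` or at `x` it is no larger than at `lam₀`, although it dominates
  -- strictly larger values there.
  obtain ⟨q', hq', hqp', he⟩ := exists_neg_dualObjective_eq_lagrangian hq ρ V hlam₀
  have h5 := neg_dualObjective_le_lagrangian hq hq' hqp' ρ V hx.1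
  have h6 := neg_dualObjective_le_lagrangian hq hq' hqp' ρ V hy.1
  set K := ∑ s, q' s * Real.log (q' s / q s) - ρ
  rcases le_total 0 K with hK | hK
  · have := mul_le_mul_of_nonneg_right hylt.le hK
    linarith
  · have := mul_le_mul_of_nonpos_right hlt.le hK
    linarith

theorem sublevelProb_le_one {p : S → ℝ} (hp : p ∈ stdSimplex ℝ S) (V : S → ℝ) (c : ℝ) :
    sublevelProb p V c ≤ 1 := by
  rw [← hp.2]
  exact Finset.sum_le_univ_sum_of_nonneg hp.1

theorem sublevelProb_add_le_expMoment {p : S → ℝ} (hp : p ∈ stdSimplex ℝ S) {V : S → ℝ} {B c : ℝ}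
    (hB : 0 ≤ B) (hV : ∀ s, V s - c ≤ B) {lam : ℝ} (hlam : 0 < lam) :
    sublevelProb p V c + (1 - sublevelProb p V c) * Real.exp (-B / lam) ≤ expMoment p V c lam := by
  have hE : Real.exp (-B / lam) ≤ 1 :=
    Real.exp_le_one_iff.2 (div_nonpos_of_nonpos_of_nonneg (by linarith) hlam.le)
  set E := Real.exp (-B / lam)
  have h1 : sublevelProb p V c + (1 - sublevelProb p V c) * E =
      ∑ s, p s * (E + if V s ≤ c then 1 - E else 0) := by
    simp only [mul_add, Finset.sum_add_distrib, mul_ite, mul_zero]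
    rw [← Finset.sum_filter, ← Finset.sum_mul, ← Finset.sum_mul, hp.2]
    change _ = 1 * E + sublevelProb p V c * (1 - E)
    ring
  rw [h1]
  refine Finset.sum_le_sum fun s _ => mul_le_mul_of_nonneg_left ?_ (hp.1 s)
  split_ifs with h
  · rw [add_sub_cancel]
    exact Real.one_le_exp (div_nonneg (by linarith) hlam.le)
  · rw [add_zero]
    exact Real.exp_le_exp.2 (div_le_div_of_nonneg_right (by linarith [hV s]) hlam.le)

/-- If the worst case for `p` is the minimum of `V` over the support, the perturbation error is
small without any lower bound on the dual variables. -/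
theorem exists_worstCase_sub_le_of_dualOptimizer_eq_zero {p : S → ℝ} (hp : p ∈ stdSimplex ℝ S)
    {ρ B : ℝ} (hρ : 0 < ρ) (hB : 0 < B) {V : S → ℝ} (hV : ∀ s, V s ∈ Set.Icc 0 B)
    (h0 : dualOptimizer p ρ B V = 0) :
    ∃ η₀ > 0, ∀ q ∈ stdSimplex ℝ S, (∀ s, p s = 0 → q s = 0) → ∀ η, 0 ≤ η → η ≤ η₀ →
      SublevelClose p q V η → |worstCase p ρ V - worstCase q ρ V| ≤ B / ρ * η := by
  obtain ⟨-, hxm⟩ := exists_isMinOn_dualObjective hp hρ hB.le V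
  rw [h0] at hxm
  have hw := exp_neg_le_sublevelProb hp
    fun lam hlam => dualObjective_le_of_isMinOn hp hρ hB.le hV hxm hlam
  have hLp : worstCase p ρ V = suppMin p V := by
    rw [worstCase_eq_neg_dualObjective hp hρ hB.le hV le_rfl hxm, dualObjective_zero, neg_neg]
  have hw0 := sublevelProb_suppMin_pos hp V
  have hw1 := sublevelProb_le_one hp V (suppMin p V)
  have hm0 := suppMin_nonneg hp fun s => (hV s).1
  have hmle : ∀ s, 0 < p s → suppMin p V ≤ V s := fun s => suppMin_le V
  obtain ⟨s₀, hs₀, hs₀m⟩ := exists_eq_suppMin hp V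
  set m := suppMin p V
  set w := sublevelProb p V m
  -- Chosen so that `c₀ * (η / (w / 2)) = B / ρ * η`.
  set c₀ := B / ρ * (w / 2) with hc₀
  have hc₀pos : 0 < c₀ := by positivity
  -- The moment of `p` at any `y ≥ c₀` exceeds `exp (-ρ)` by at least this amount. It is positive
  -- because `exp (-ρ) ≤ w`, strictly if `w = 1`.
  have hκ : 0 < w + (1 - w) * Real.exp (-B / c₀) - Real.exp (-ρ) := by
    rcases hw1.eq_or_lt with h1 | h1
    · rw [h1]
      have : Real.exp (-ρ) < 1 := Real.exp_lt_one_iff.2 (by linarith)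
      linarith
    · have := mul_pos (sub_pos.2 h1) (Real.exp_pos (-B / c₀))
      linarith
  set κ := w + (1 - w) * Real.exp (-B / c₀) - Real.exp (-ρ) with hκdef
  refine ⟨min (w / 2) (κ / 2), lt_min (by linarith) (by linarith),
    fun q hq hqp η hη hη₀ hcl => ?_⟩
  have hη1 := hη₀.trans (min_le_left _ _)
  have hη2 := hη₀.trans (min_le_right _ _)
  have hppos : ∀ s, 0 < q s → 0 < p s := fun s hs =>
    (hp.1 s).lt_of_ne fun h => hs.ne' (hqp s h.symm)
  have hLq : m ≤ worstCase q ρ V := le_worstCase hq hρ.le fun s hs => hmle s (hppos s hs)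
  have hqw : w / 2 ≤ sublevelProb q V m := by
    have := (abs_le.1 (hcl s₀)).1
    rw [hs₀m] at this
    linarith
  rw [hLp, abs_sub_comm, abs_of_nonneg (by linarith)]
  obtain ⟨hy, hym⟩ := exists_isMinOn_dualObjective hq hρ hB.le V
  have hLq' := worstCase_eq_neg_dualObjective hq hρ hB.le hV hy.1 hym
  set y := dualOptimizer q ρ B V
  have hBη : 0 ≤ B / ρ * η := by positivity
  rcases hy.1.eq_or_lt with hy0 | hy0
  · rw [← hy0, dualObjective_zero, neg_neg] at hLq'
    obtain ⟨s, hs, hs'⟩ := Finset.exists_ne_zero_of_sum_ne_zero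
      (show sublevelProb q V m ≠ 0 by linarith [hqw, hw0])
    have h1 : suppMin q V ≤ V s := suppMin_le V ((hq.1 s).lt_of_ne (Ne.symm hs'))
    have h2 : V s ≤ m := by simpa using hs
    linarith
  · have hZ : |expMoment q V m y - expMoment p V m y| ≤ η := by
      have hφ : Antitone fun v : ℝ => Real.exp (-(max v m - m) / y) := fun a b hab =>
        Real.exp_le_exp.2 (div_le_div_of_nonneg_right
          (neg_le_neg (sub_le_sub_right (max_le_max hab le_rfl) _)) hy0.le)
      have h1 := hcl.abs_sum_sub_le hη hφ fun v => ⟨(Real.exp_pos _).le, Real.exp_le_one_iff.2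
        (div_nonpos_of_nonpos_of_nonneg (neg_nonpos.2 (sub_nonneg.2 (le_max_right _ _))) hy0.le)⟩
      have h2 : ∀ p' : S → ℝ, (∀ s, p s = 0 → p' s = 0) →
          ∑ s, p' s * Real.exp (-(max (V s) m - m) / y) = expMoment p' V m y := by
        refine fun p' hp' => Finset.sum_congr rfl fun s _ => ?_
        rcases (hp.1 s).eq_or_lt with h3 | h3
        · rw [hp' s h3.symm, zero_mul, zero_mul]
        · rw [max_eq_left (hmle s h3)]
      rwa [h2 q hqp, h2 p fun _ h => h] at h1
    have hZq := expMoment_pos hq V m y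
    -- The support of `q` lies in that of `p`, so the worst case for `q` is at least `m`, and this
    -- caps the moment at the optimal `y`. With `η ≤ κ / 2` it excludes `y ≥ c₀`.
    have hZq' : expMoment q V m y ≤ Real.exp (-ρ) := by
      rw [hLq', dualObjective_eq hq ρ V m hy0] at hLq
      have h1 : y * (ρ + Real.log (expMoment q V m y)) ≤ 0 := by linarith
      have h2 := nonpos_of_mul_nonpos_right h1 hy0
      rw [← Real.log_le_iff_le_exp hZq]
      linarith
    have hyc : y < c₀ := by
      by_contra! hcon
      have h1 := sublevelProb_add_le_expMoment hp hB.le (V := V) (c := m)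
        (fun s => by linarith [(hV s).2]) hy0
      have h2 : Real.exp (-B / c₀) ≤ Real.exp (-B / y) := by
        rw [neg_div, neg_div]
        exact Real.exp_le_exp.2 (neg_le_neg (div_le_div_of_nonneg_left hB.le hc₀pos hcon))
      have h3 := mul_le_mul_of_nonneg_left h2 (sub_nonneg.2 hw1)
      change w + (1 - w) * _ ≤ _ at h1
      linarith [(abs_le.1 hZ).1]
    have hd := abs_dualObjective_sub_le hp hq ρ V m hy0 (half_pos hw0)
      ((half_le_self hw0.le).trans (sublevelProb_le_expMoment hp V m hy0))
      (hqw.trans (sublevelProb_le_expMoment hq V m hy0)) hZ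
    have h1 := neg_dualObjective_le_worstCase hp hρ.le V hy0.le
    rw [hLp] at h1
    have h2 : y * (η / (w / 2)) ≤ B / ρ * η := by
      calc y * (η / (w / 2)) ≤ c₀ * (η / (w / 2)) :=
            mul_le_mul_of_nonneg_right hyc.le (by positivity)
        _ = B / ρ * η := by rw [hc₀]; field_simp
    linarith [(abs_le.1 hd).1]

/-- The stability of the worst-case expectation under small perturbations of the nominal
distribution, with a constant governed by the optimal dual variable. -/
theorem exists_abs_worstCase_sub_le {p : S → ℝ} (hp : p ∈ stdSimplex ℝ S) {ρ B : ℝ} (hρ : 0 < ρ)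
    (hB : 0 < B) {V : S → ℝ} (hV : ∀ s, V s ∈ Set.Icc 0 B) {lam₀ : ℝ} (hlam₀ : 0 < lam₀)
    (hlam : lam₀ ≤ if 0 < dualOptimizer p ρ B V ∧ dualOptimizer p ρ B V < 1
      then dualOptimizer p ρ B V / 2 else 1 / 2) :
    ∃ η₀ > 0, ∀ q ∈ stdSimplex ℝ S, (∀ s, p s = 0 → q s = 0) → ∀ η, 0 ≤ η → η ≤ η₀ →
      SublevelClose p q V η →
      |worstCase p ρ V - worstCase q ρ V| ≤ B / ρ * Real.exp (B / lam₀) * η := by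
  have hx := (exists_isMinOn_dualObjective hp hρ hB.le V).1
  rcases hx.1.eq_or_lt with h0 | h0
  · obtain ⟨η₀, hη₀, h⟩ :=
      exists_worstCase_sub_le_of_dualOptimizer_eq_zero hp hρ hB hV h0.symm
    refine ⟨η₀, hη₀, fun q hq hqp η hη hle hcl => (h q hq hqp η hη hle hcl).trans ?_⟩
    refine mul_le_mul_of_nonneg_right ?_ hη
    exact le_mul_of_one_le_right (by positivity) (Real.one_le_exp (by positivity))
  · have hlt : lam₀ < dualOptimizer p ρ B V := by
      split_ifs at hlam with h1
      · linarith
      · have : 1 ≤ dualOptimizer p ρ B V := by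
          by_contra! h2
          exact h1 ⟨h0, h2⟩
        linarith
    obtain ⟨η₀, hη₀, h⟩ := exists_le_dualOptimizer_of_sublevelClose hp hρ hB hV hlam₀ hlt
    exact ⟨η₀, hη₀, fun q hq _ η hη hle hcl =>
      hcl.abs_worstCase_sub_le hp hq hρ hB.le hV hη hlam₀ hlt.le (h q hq η hη hle hcl)⟩

end Perturbation

/-! ### Propagation of one-step errors. -/

section ErrorPropagation

variable {S A : Type*} [Fintype S] {H : ℕ}

theorem abs_worstCase_sub_worstCase_le {p : S → ℝ} (hp : p ∈ stdSimplex ℝ S) {ρ : ℝ} (hρ : 0 ≤ ρ)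
    {V W : S → ℝ} {c : ℝ} (h : ∀ s, |V s - W s| ≤ c) :
    |worstCase p ρ V - worstCase p ρ W| ≤ c := by
  have h1 := worstCase_le_worstCase_add hp hρ (V := V) (W := W) (c := c)
    fun s => by linarith [(abs_le.1 (h s)).2]
  have h2 := worstCase_le_worstCase_add hp hρ (V := W) (W := V) (c := c)
    fun s => by linarith [(abs_le.1 (h s)).1]
  exact abs_le.2 ⟨by linarith, by linarith⟩

theorem abs_ciSup_sub_ciSup_le {ι : Type*} [Finite ι] [Nonempty ι] {f g : ι → ℝ} {c : ℝ}
    (h : ∀ i, |f i - g i| ≤ c) : |(⨆ i, f i) - ⨆ i, g i| ≤ c := by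
  have h1 : ⨆ i, f i ≤ (⨆ i, g i) + c := ciSup_le fun i => by
    linarith [(abs_le.1 (h i)).2, le_ciSup (Set.finite_range g).bddAbove i]
  have h2 : ⨆ i, g i ≤ (⨆ i, f i) + c := ciSup_le fun i => by
    linarith [(abs_le.1 (h i)).1, le_ciSup (Set.finite_range f).bddAbove i]
  exact abs_le.2 ⟨by linarith, by linarith⟩

variable [Finite A] [Nonempty A] (r : Fin H → S → A → ℝ) {P Q : Fin H → S → A → S → ℝ} {ρ : ℝ}

/-- The worst case is nonexpansive in the value function, so one-step errors add up. They are needed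
only at the values of `P`, which may be the empirical or the nominal model. -/
theorem abs_greedyValue_sub_le (hQ : ∀ h s a, Q h s a ∈ stdSimplex ℝ S) (hρ : 0 ≤ ρ) {e : ℝ}
    (he : ∀ (h : Fin H) s a, |worstCase (P h s a) ρ (greedyValue r P ρ h.succ) -
      worstCase (Q h s a) ρ (greedyValue r P ρ h.succ)| ≤ e) (k : Fin (H + 1)) :
    ∀ s, |greedyValue r P ρ k s - greedyValue r Q ρ k s| ≤ (H - k) * e := by
  induction k using Fin.reverseInduction with
  | last => intro s; simp [greedyValue_last]
  | cast h ih =>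
    intro s
    rw [greedyValue_castSucc, greedyValue_castSucc]
    refine abs_ciSup_sub_ciSup_le fun a => ?_
    have h1 := abs_worstCase_sub_worstCase_le (hQ h s a) hρ ih
    rw [add_sub_add_left_eq_sub]
    refine (abs_sub_le _ _ _).trans ((add_le_add (he h s a) h1).trans (le_of_eq ?_))
    simp
    ring

theorem greedyValue_castSucc_of_isRPVLOutput [DecidableEq S] {N : ℕ} {r : Fin H → S → A → ℝ}
    {ρ : ℝ} {D : Dataset S A H N} {π : Policy S A H} (hπ : IsRPVLOutput r ρ D π) (h : Fin H)
    (s : S) : greedyValue r (empirical D) ρ h.castSucc s = r h s (π h s) +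
      worstCase (empirical D h s (π h s)) ρ (greedyValue r (empirical D) ρ h.succ) := by
  rw [greedyValue_castSucc]
  exact le_antisymm (ciSup_le fun a => hπ h s a) (le_ciSup (f := fun a => r h s a +
    worstCase (empirical D h s a) ρ (greedyValue r (empirical D) ρ h.succ))
    (Set.finite_range _).bddAbove _)

variable [DecidableEq S] {N : ℕ} (M : MDP S A H) {D : Dataset S A H N} {π : Policy S A H}

/-- The policy error in terms of the estimation errors at the algorithm's value functions. -/
theorem abs_greedyValue_sub_bellmanValue_le (hρ : 0 ≤ ρ) (hπ : IsRPVLOutput M.reward ρ D π) {e : ℝ}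
    (he : ∀ (h : Fin H) s a,
      |worstCase (empirical D h s a) ρ (greedyValue M.reward (empirical D) ρ h.succ) -
        worstCase (M.trans h s a) ρ (greedyValue M.reward (empirical D) ρ h.succ)| ≤ e)
    (k : Fin (H + 1)) (s : S) :
    |greedyValue M.reward M.trans ρ k s - bellmanValue M ρ π k s| ≤ 2 * (H - k) * e := by
  have h1 := abs_greedyValue_sub_le M.reward M.trans_mem hρ he k s
  have h2 : ∀ s, |greedyValue M.reward (empirical D) ρ k s - bellmanValue M ρ π k s| ≤
      (H - k) * e := by
    clear h1
    induction k using Fin.reverseInduction with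
    | last => intro s; simp [greedyValue_last, bellmanValue_last]
    | cast h ih =>
      intro s
      rw [greedyValue_castSucc_of_isRPVLOutput hπ, bellmanValue_castSucc, add_sub_add_left_eq_sub]
      have h1 := abs_worstCase_sub_worstCase_le (M.trans_mem h s (π h s)) hρ ih
      refine (abs_sub_le _ _ _).trans ((add_le_add (he h s _) h1).trans (le_of_eq ?_))
      simp
      ring
  rw [abs_sub_comm] at h1
  refine (abs_sub_le _ _ _).trans ((add_le_add h1 (h2 s)).trans (le_of_eq ?_))
  ring

/-- The policy error in terms of the estimation errors at the optimal value functions. -/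
theorem abs_greedyValue_sub_bellmanValue_le_of_optimal (hρ : 0 ≤ ρ)
    (hD : ∀ h s a, empirical D h s a ∈ stdSimplex ℝ S) (hπ : IsRPVLOutput M.reward ρ D π) {e : ℝ}
    (he : ∀ (h : Fin H) s a,
      |worstCase (M.trans h s a) ρ (greedyValue M.reward M.trans ρ h.succ) -
        worstCase (empirical D h s a) ρ (greedyValue M.reward M.trans ρ h.succ)| ≤ e)
    (k : Fin (H + 1)) : ∀ s, |greedyValue M.reward M.trans ρ k s - bellmanValue M ρ π k s| ≤
      (H - k) * (H - k + 1) * e := by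
  have h1 := abs_greedyValue_sub_le M.reward hD hρ he
  induction k using Fin.reverseInduction with
  | last => intro s; simp [greedyValue_last, bellmanValue_last]
  | cast h ih =>
    intro s
    have h2 := h1 h.castSucc s
    -- One-step errors are known only at the optimal values. The comparison therefore passes to them
    -- under the empirical kernel, changes the kernel, and goes on to the values of `π` under the
    -- nominal one; repeating the detour at every time makes the bound quadratic.
    have h3 : |greedyValue M.reward (empirical D) ρ h.castSucc s -
        bellmanValue M ρ π h.castSucc s| ≤ (H - (h.succ : Fin (H + 1))) * e + e +
          (H - (h.succ : Fin (H + 1))) * (H - (h.succ : Fin (H + 1)) + 1) * e := by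
      rw [greedyValue_castSucc_of_isRPVLOutput hπ, bellmanValue_castSucc, add_sub_add_left_eq_sub]
      have e1 := abs_worstCase_sub_worstCase_le (hD h s (π h s)) hρ (h1 h.succ)
      rw [abs_sub_comm] at e1
      have e2 := he h s (π h s)
      rw [abs_sub_comm] at e2
      have e3 := abs_worstCase_sub_worstCase_le (M.trans_mem h s (π h s)) hρ ih
      refine (abs_sub_le _ _ _).trans (add_le_add ((abs_sub_le _ _ _).trans
        (add_le_add e1 e2)) e3)
    refine (abs_sub_le _ _ _).trans ((add_le_add h2 h3).trans (le_of_eq ?_))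
    simp
    ring

end ErrorPropagation

/-! ### Empirical transition vectors. -/

section Frequencies

theorem sum_card_div_eq {S : Type*} [DecidableEq S] {N : ℕ} (z : Fin N → S) (T : Finset S) :
    ∑ s ∈ T, (Finset.card {i : Fin N | z i = s} : ℝ) / N =
      (∑ i, if z i ∈ T then (1 : ℝ) else 0) / N := by
  rw [← Finset.sum_div]
  congr 1
  simp only [Finset.card_filter, Nat.cast_sum, Nat.cast_ite, Nat.cast_one, Nat.cast_zero]
  rw [Finset.sum_comm]
  refine Finset.sum_congr rfl fun i _ => ?_
  rw [Finset.sum_ite_eq]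

variable {S A : Type*} [Fintype S] [DecidableEq S] {H N : ℕ}

theorem empirical_mem_stdSimplex (hN : 0 < N) (D : Dataset S A H N) (h : Fin H) (s : S) (a : A) :
    empirical D h s a ∈ stdSimplex ℝ S := by
  refine ⟨fun s' => div_nonneg (Nat.cast_nonneg _) (Nat.cast_nonneg _), ?_⟩
  have := sum_card_div_eq (D h s a) Finset.univ
  simp only [Finset.mem_univ, if_true, Finset.sum_const, Finset.card_univ, Fintype.card_fin,
    nsmul_eq_mul, mul_one] at this
  exact this.trans (div_self (Nat.cast_pos.2 hN).ne')

/-- The value functions of the algorithm at time `k` depend only on the samples from time `k` on. -/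
theorem greedyValue_empirical_congr (r : Fin H → S → A → ℝ) (ρ : ℝ) (D D' : Dataset S A H N)
    (k : Fin (H + 1)) (hD : ∀ t : Fin H, k ≤ t.castSucc → D t = D' t) :
    greedyValue r (empirical D) ρ k = greedyValue r (empirical D') ρ k := by
  induction k using Fin.reverseInduction with
  | last => funext s; rw [greedyValue_last, greedyValue_last]
  | cast h ih =>
    funext s
    rw [greedyValue_castSucc, greedyValue_castSucc,
      ih fun t ht => hD t ((Fin.castSucc_lt_succ (i := h)).le.trans ht)]
    have : ∀ a, empirical D h s a = empirical D' h s a := fun a => by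
      funext s'
      simp only [empirical, hD h le_rfl]
    simp only [this]

end Frequencies

/-! ### Concentration under the generative model. -/

section Concentration

variable {S : Type*} [Fintype S] [DecidableEq S] [MeasurableSpace S]
  {Ω : Type*} [MeasurableSpace Ω] {μ : Measure Ω} [IsProbabilityMeasure μ] {N : ℕ}

variable {A : Type*} {H : ℕ} {M : MDP S A H} {X : Ω → Dataset S A H N}

/-- Finitely many samples each avoid nominal null states almost surely. This provides the support
condition used when the dual variable vanishes. -/
theorem IsGenerativeSample.measureReal_not_absolutelyContinuous [Finite A]
    (hX : IsGenerativeSample M μ X) :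
    μ.real {ω | ∃ h s a s', M.trans h s a s' = 0 ∧ empirical (X ω) h s a s' ≠ 0} = 0 := by
  classical
  have := Fintype.ofFinite A
  set B : Fin H × S × A × Fin N × S → Set Ω := fun j =>
    {ω | M.trans j.1 j.2.1 j.2.2.1 j.2.2.2.2 = 0 ∧
      X ω j.1 j.2.1 j.2.2.1 j.2.2.2.1 = j.2.2.2.2} with hB
  have hincl : {ω | ∃ h s a s', M.trans h s a s' = 0 ∧ empirical (X ω) h s a s' ≠ 0} ⊆
      ⋃ j, B j := by
    rintro ω ⟨h, s, a, s', h0, hne⟩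
    by_contra hcon
    refine hne ?_
    have : ({i : Fin N | X ω h s a i = s'} : Finset (Fin N)) = ∅ := by
      ext i
      simp only [Finset.mem_filter, Finset.mem_univ, true_and, Finset.notMem_empty, iff_false]
      exact fun hi => hcon (Set.mem_iUnion.2 ⟨(h, s, a, i, s'), h0, hi⟩)
    rw [empirical, this, Finset.card_empty, Nat.cast_zero, zero_div]
  refine le_antisymm ?_ measureReal_nonneg
  calc _ ≤ _ := measureReal_mono hincl
    _ ≤ ∑ j, μ.real (B j) := measureReal_iUnion_fintype_le _
    _ = 0 := Finset.sum_eq_zero fun j _ => by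
      by_cases h0 : M.trans j.1 j.2.1 j.2.2.1 j.2.2.2.2 = 0
      · simp only [hB, h0, true_and]
        rw [hX.law, h0]
      · simp [hB, h0]

variable [MeasurableSingletonClass S]

/-- Hoeffding's inequality for the relative frequency of a set. -/
theorem measureReal_lt_abs_frequency_sub_le {Z : Fin N → Ω → S} (hZ : ∀ i, Measurable (Z i))
    (hind : iIndepFun Z μ) {p : S → ℝ} (hp : ∀ i s, μ.real {ω | Z i ω = s} = p s)
    (hN : 0 < N) (T : Finset S) {η : ℝ} (hη : 0 ≤ η) :
    μ.real {ω | η < |∑ s ∈ T, (Finset.card {i : Fin N | Z i ω = s} : ℝ) / N - ∑ s ∈ T, p s|} ≤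
      2 * Real.exp (-2 * N * η ^ 2) := by
  have hN' : (0 : ℝ) < N := Nat.cast_pos.2 hN
  set m := ∑ s ∈ T, p s with hm
  set g : S → ℝ := fun s => if s ∈ T then 1 else 0
  have hg : Measurable g := measurable_of_finite g
  have hint : ∀ i, ∫ ω, (g ∘ Z i) ω ∂μ = m := by
    intro i
    have h1 : ∀ ω, (g ∘ Z i) ω = ∑ s ∈ T, Set.indicator {ω | Z i ω = s} (fun _ => (1 : ℝ)) ω := by
      intro ω
      simp [g, Set.indicator_apply]
    have hms : ∀ s, MeasurableSet {ω | Z i ω = s} := fun s => hZ i (measurableSet_singleton s)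
    simp only [h1]
    rw [integral_finsetSum _ fun s _ => (integrable_const _).indicator (hms s)]
    refine Finset.sum_congr rfl fun s _ => ?_
    rw [integral_indicator_const _ (hms s), hp, smul_eq_mul, mul_one]
  have hsub : ∀ i, HasSubgaussianMGF (fun ω => (g ∘ Z i) ω - m) ((‖(1 : ℝ) - 0‖₊ / 2) ^ 2) μ := by
    intro i
    have := hasSubgaussianMGF_of_mem_Icc (μ := μ) (X := g ∘ Z i) (a := 0) (b := 1)
      (hg.comp (hZ i)).aemeasurable (Filter.Eventually.of_forall fun ω => by
        simp only [g, Function.comp]; split_ifs <;> simp)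
    rwa [hint i] at this
  have hind1 : iIndepFun (fun i ω => (g ∘ Z i) ω - m) μ :=
    hind.comp (fun _ s => g s - m) fun _ => hg.sub_const m
  have hind2 : iIndepFun (fun i => -(fun ω => (g ∘ Z i) ω - m)) μ :=
    hind.comp (fun _ s => -(g s - m)) fun _ => (hg.sub_const m).neg
  have e1 := HasSubgaussianMGF.measure_sum_ge_le_of_iIndepFun hind1 (s := Finset.univ)
    (fun i _ => hsub i) (mul_nonneg hN'.le hη)
  have e2 := HasSubgaussianMGF.measure_sum_ge_le_of_iIndepFun hind2 (s := Finset.univ)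
    (fun i _ => (hsub i).neg) (mul_nonneg hN'.le hη)
  -- A variable in `[0, 1]` has sub-Gaussian parameter `1 / 4`, so the denominator is `N / 2`.
  have hexp : -(N * η) ^ 2 /
      (2 * ∑ i : Fin N, (((‖(1 : ℝ) - 0‖₊ / 2) ^ 2 : NNReal) : ℝ)) = -2 * N * η ^ 2 := by
    simp
    field_simp
  rw [NNReal.coe_sum, hexp] at e1 e2
  have hincl : {ω | η < |∑ s ∈ T, (Finset.card {i : Fin N | Z i ω = s} : ℝ) / N - m|} ⊆
      {ω | N * η ≤ ∑ i, ((g ∘ Z i) ω - m)} ∪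
        {ω | N * η ≤ ∑ i, (-(fun ω => (g ∘ Z i) ω - m)) ω} := by
    intro ω hω
    have h1 : ∑ i, ((g ∘ Z i) ω - m) =
        N * (∑ s ∈ T, (Finset.card {i : Fin N | Z i ω = s} : ℝ) / N - m) := by
      rw [sum_card_div_eq fun i => Z i ω, mul_sub, mul_div_cancel₀ _ hN'.ne']
      simp [g]
    have h2 : ∑ i, (-(fun ω => (g ∘ Z i) ω - m)) ω = -∑ i, ((g ∘ Z i) ω - m) := by
      rw [← Finset.sum_neg_distrib]
      rfl
    rcases lt_abs.1 (show η < |_| from hω) with h | h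
    · left
      rw [Set.mem_ofPred_eq, h1]
      exact mul_le_mul_of_nonneg_left h.le hN'.le
    · right
      rw [Set.mem_ofPred_eq, h2, h1, ← mul_neg]
      exact mul_le_mul_of_nonneg_left h.le hN'.le
  calc _ ≤ _ := measureReal_mono hincl
    _ ≤ _ := measureReal_union_le _ _
    _ ≤ _ := by rw [two_mul]; exact add_le_add e1 e2

theorem IsGenerativeSample.measureReal_lt_abs_empirical_sub_le (hX : IsGenerativeSample M μ X)
    (hN : 0 < N) (h : Fin H) (s : S) (a : A) (T : Finset S) {η : ℝ} (hη : 0 ≤ η) :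
    μ.real {ω | η < |∑ s' ∈ T, empirical (X ω) h s a s' - ∑ s' ∈ T, M.trans h s a s'|} ≤
      2 * Real.exp (-2 * N * η ^ 2) :=
  measureReal_lt_abs_frequency_sub_le (Z := fun i ω => X ω h s a i) (hX.measurable h s a)
    (hX.indep.precomp (g := fun i : Fin N => (h, s, a, i)) fun i j hij => by simpa using hij)
    (hX.law h s a) hN T hη

/-- The concentration of the frequencies of a set that is a function of later samples. -/
theorem IsGenerativeSample.measureReal_lt_abs_empirical_sub_le_of_later [Finite A]
    (hX : IsGenerativeSample M μ X) (hN : 0 < N) (h : Fin H) (s : S) (a : A)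
    {T : Dataset S A H N → Finset S} (hT : ∀ D D', (∀ t, h < t → D t = D' t) → T D = T D')
    {η : ℝ} (hη : 0 ≤ η) :
    μ.real {ω | η < |∑ s' ∈ T (X ω), empirical (X ω) h s a s' -
      ∑ s' ∈ T (X ω), M.trans h s a s'|} ≤ 2 * Real.exp (-2 * N * η ^ 2) := by
  classical
  have := Fintype.ofFinite A
  set f : Fin H × S × A × Fin N → Ω → S := fun j ω => X ω j.1 j.2.1 j.2.2.1 j.2.2.2 with hf
  have hfm : ∀ j, Measurable (f j) := fun j => hX.measurable _ _ _ _
  set I : Finset (Fin H × S × A × Fin N) := {j | h < j.1} with hI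
  set J : Finset (Fin H × S × A × Fin N) := {j | j.1 = h ∧ j.2.1 = s ∧ j.2.2.1 = a} with hJ
  have hIJ : Disjoint I J := by
    rw [Finset.disjoint_left]
    intro j hj hj'
    simp only [hI, hJ, Finset.mem_filter, Finset.mem_univ, true_and] at hj hj'
    exact hj.ne' hj'.1
  have hind := hX.indep.indepFun_finset I J hIJ hfm
  -- The value `T₀` of the random set is decided by samples after `h`, the deviation for fixed `T₀`
  -- by those at `(h, s, a)`. These blocks are independent, so summing over `T₀` weights Hoeffding's
  -- bound by total mass one.
  set E : Finset S → Set Ω := fun T₀ => {ω | T (X ω) = T₀} with hE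
  set B : Finset S → Set Ω := fun T₀ =>
    {ω | η < |∑ s' ∈ T₀, empirical (X ω) h s a s' - ∑ s' ∈ T₀, M.trans h s a s'|} with hB
  -- The finite product of discrete spaces makes any set `E'` measurable, so it is enough that the
  -- event is determined by the coordinates in `I`.
  have hEp : ∀ T₀, ∃ E' : Set (I → S), E T₀ = (fun ω (i : I) => f i ω) ⁻¹' E' := by
    intro T₀
    refine ⟨{z | ∃ ω, T (X ω) = T₀ ∧ z = fun i : I => f i ω}, ?_⟩
    ext ω
    refine ⟨fun hω => ⟨ω, hω, rfl⟩, fun ⟨ω', hω', he⟩ => ?_⟩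
    refine Eq.trans (hT _ _ fun t ht => ?_) hω'
    funext s' a' i
    exact congrFun he ⟨(t, s', a', i), by simpa [hI] using ht⟩
  have hBp : ∀ T₀, ∃ B' : Set (J → S), B T₀ = (fun ω (i : J) => f i ω) ⁻¹' B' := by
    intro T₀
    refine ⟨{z | ∃ ω, ω ∈ B T₀ ∧ z = fun i : J => f i ω}, ?_⟩
    ext ω
    refine ⟨fun hω => ⟨ω, hω, rfl⟩, fun ⟨ω', hω', he⟩ => ?_⟩
    have h1 : ∀ i, X ω h s a i = X ω' h s a i := fun i =>
      congrFun he ⟨(h, s, a, i), by simp [hJ]⟩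
    have h2 : ∀ s', empirical (X ω) h s a s' = empirical (X ω') h s a s' := fun s' => by
      simp only [empirical, h1]
    simp only [hB, Set.mem_ofPred_eq, h2] at hω' ⊢
    exact hω'
  have hEm : ∀ T₀, MeasurableSet (E T₀) := fun T₀ => by
    obtain ⟨E', hE'⟩ := hEp T₀
    rw [hE']
    exact measurable_pi_lambda _ (fun i : I => hfm i) (MeasurableSet.of_discrete)
  have hmul : ∀ T₀, μ.real (E T₀ ∩ B T₀) = μ.real (E T₀) * μ.real (B T₀) := by
    intro T₀
    obtain ⟨E', hE'⟩ := hEp T₀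
    obtain ⟨B', hB'⟩ := hBp T₀
    rw [hE', hB', measureReal_def, hind.measure_inter_preimage_eq_mul _ _
      MeasurableSet.of_discrete MeasurableSet.of_discrete, ENNReal.toReal_mul]
    rfl
  have hincl : {ω | η < |∑ s' ∈ T (X ω), empirical (X ω) h s a s' -
      ∑ s' ∈ T (X ω), M.trans h s a s'|} ⊆ ⋃ T₀, E T₀ ∩ B T₀ :=
    fun ω hω => Set.mem_iUnion.2 ⟨T (X ω), rfl, hω⟩
  have hsum : ∑ T₀, μ.real (E T₀) = 1 := by
    rw [← measureReal_iUnion_fintype (fun T₀ T₁ hne => Set.disjoint_left.2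
      fun ω h1 h2 => hne (h1.symm.trans h2)) hEm]
    have : ⋃ T₀, E T₀ = Set.univ := Set.eq_univ_of_forall fun ω => Set.mem_iUnion.2 ⟨_, rfl⟩
    rw [this, probReal_univ]
  calc _ ≤ _ := measureReal_mono hincl
    _ ≤ ∑ T₀, μ.real (E T₀ ∩ B T₀) := measureReal_iUnion_fintype_le _
    _ ≤ ∑ T₀, μ.real (E T₀) * (2 * Real.exp (-2 * N * η ^ 2)) := by
      refine Finset.sum_le_sum fun T₀ _ => ?_
      rw [hmul]
      exact mul_le_mul_of_nonneg_left
        (hX.measureReal_lt_abs_empirical_sub_le hN h s a T₀ hη) measureReal_nonneg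
    _ = _ := by rw [← Finset.sum_mul, hsum, one_mul]

/-- The uniform concentration of the empirical distribution functions of value functions that
depend on later samples only. -/
theorem IsGenerativeSample.measureReal_not_sublevelClose_le [Fintype A]
    (hX : IsGenerativeSample M μ X) (hN : 0 < N) {V : Dataset S A H N → Fin H → S → ℝ}
    (hV : ∀ h D D', (∀ t, h < t → D t = D' t) → V D h = V D' h) {η : ℝ} (hη : 0 ≤ η) :
    μ.real {ω | ∃ h s a, ¬ SublevelClose (M.trans h s a) (empirical (X ω) h s a) (V (X ω) h) η} ≤
      H * Fintype.card S ^ 2 * Fintype.card A * (2 * Real.exp (-2 * N * η ^ 2)) := by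
  -- The last coordinate is the state whose value is the threshold; it accounts for the second
  -- factor `Fintype.card S`.
  set B : Fin H × S × A × S → Set Ω := fun j => {ω | η <
    |∑ s' with V (X ω) j.1 s' ≤ V (X ω) j.1 j.2.2.2, empirical (X ω) j.1 j.2.1 j.2.2.1 s' -
      ∑ s' with V (X ω) j.1 s' ≤ V (X ω) j.1 j.2.2.2, M.trans j.1 j.2.1 j.2.2.1 s'|} with hB
  have hincl : {ω | ∃ h s a,
      ¬ SublevelClose (M.trans h s a) (empirical (X ω) h s a) (V (X ω) h) η} ⊆ ⋃ j, B j := by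
    rintro ω ⟨h, s, a, hc⟩
    unfold SublevelClose at hc
    push Not at hc
    obtain ⟨s', hs'⟩ := hc
    exact Set.mem_iUnion.2 ⟨(h, s, a, s'), hs'⟩
  calc _ ≤ _ := measureReal_mono hincl
    _ ≤ ∑ j, μ.real (B j) := measureReal_iUnion_fintype_le _
    _ ≤ ∑ j : Fin H × S × A × S, 2 * Real.exp (-2 * N * η ^ 2) :=
      Finset.sum_le_sum fun j _ => hX.measureReal_lt_abs_empirical_sub_le_of_later hN j.1 j.2.1
        j.2.2.1 (T := fun D => {s' | V D j.1 s' ≤ V D j.1 j.2.2.2})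
        (fun D D' hD => by simp only [hV j.1 D D' hD]) hη
    _ = _ := by
      rw [Finset.sum_const, Finset.card_univ, nsmul_eq_mul]
      simp only [Fintype.card_prod, Fintype.card_fin]
      push_cast
      ring

end Concentration

/-! ### Arithmetic of the sample size. -/

section SampleSize

/-- `G` is the horizon factor in the tolerance `η = ε * ρ / (G * exp (H / lam))`. Of the three
exponentials in `sampleSizeKL`, two are spent on `η ^ 2` and the third on `G ^ 2`, through `hGH`. -/
theorem two_mul_log_le_of_sampleSizeKL_le {nS nA H N : ℕ} (hS : 0 < nS) (hA : 0 < nA) (hH : 0 < H)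
    {ρ ε δ lam G : ℝ} (hρ : 0 < ρ) (hε : 0 < ε) (hδ : δ ∈ Set.Ioo (0 : ℝ) 1)
    (hlam : lam ∈ Set.Ioo (0 : ℝ) 1) (hG : 0 < G) (hGH : G ^ 2 ≤ 2 * Real.exp (H / lam) * H ^ 4)
    (h : sampleSizeKL nS nA H ρ ε δ lam ≤ (N : ℝ) * nS * nA * H) :
    0 < Real.log (8 * H * nS * nA / (lam * δ)) ∧
    2 * Real.log (8 * H * nS * nA / (lam * δ)) ≤
      2 * N * (ε * ρ / (G * Real.exp (H / lam))) ^ 2 := by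
  have hS' : (1 : ℝ) ≤ nS := Nat.one_le_cast.2 hS
  have hA' : (1 : ℝ) ≤ nA := Nat.one_le_cast.2 hA
  have hH' : (1 : ℝ) ≤ H := Nat.one_le_cast.2 hH
  have hlamδ : 0 < lam * δ := mul_pos hlam.1 hδ.1
  have hlamδ1 : lam * δ < 1 := mul_lt_one_of_nonneg_of_lt_one_left hlam.1.le hlam.2 hδ.2.le
  have hprod : (1 : ℝ) ≤ H * nS * nA := one_le_mul_of_one_le_of_one_le
    (one_le_mul_of_one_le_of_one_le hH' hS') hA'
  have hL : 0 < Real.log (8 * H * nS * nA / (lam * δ)) := by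
    refine Real.log_pos ((one_lt_div hlamδ).2 ?_)
    nlinarith
  refine ⟨hL, ?_⟩
  set L := Real.log (8 * H * nS * nA / (lam * δ))
  have he : Real.exp (3 * H / lam) = Real.exp (H / lam) ^ 3 := by
    rw [← Real.exp_nat_mul]
    congr 1
    push_cast
    ring
  have hEpos := Real.exp_pos (H / lam)
  rw [sampleSizeKL, he] at h
  set E := Real.exp (H / lam)
  have hK : 0 < (nS : ℝ) * nA * H := by positivity
  have h1 : 2 * E ^ 3 * H ^ 4 / (ρ ^ 2 * ε ^ 2) * L ≤ N := by
    refine le_of_mul_le_mul_right ?_ hK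
    calc _ = 2 * E ^ 3 * H ^ 5 * nS * nA / (ρ ^ 2 * ε ^ 2) * L := by ring
      _ ≤ _ := h
      _ = _ := by ring
  calc 2 * L ≤ 2 * L * (2 * E * H ^ 4 / G ^ 2) :=
        le_mul_of_one_le_right (by linarith) ((one_le_div (by positivity)).2 hGH)
    _ = 2 * (2 * E ^ 3 * H ^ 4 / (ρ ^ 2 * ε ^ 2) * L) * (ε * ρ / (G * E)) ^ 2 := by
        field_simp
    _ ≤ _ := by gcongr

theorem sampleSize_pos {nS nA H N : ℕ} (hS : 0 < nS) (hA : 0 < nA) (hH : 0 < H)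
    {ρ ε δ lam G : ℝ} (hρ : 0 < ρ) (hε : 0 < ε) (hδ : δ ∈ Set.Ioo (0 : ℝ) 1)
    (hlam : lam ∈ Set.Ioo (0 : ℝ) 1) (hG : 0 < G) (hGH : G ^ 2 ≤ 2 * Real.exp (H / lam) * H ^ 4)
    (h : sampleSizeKL nS nA H ρ ε δ lam ≤ (N : ℝ) * nS * nA * H) : 0 < N := by
  obtain ⟨h1, h2⟩ := two_mul_log_le_of_sampleSizeKL_le hS hA hH hρ hε hδ hlam hG hGH h
  rcases Nat.eq_zero_or_pos N with rfl | h3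
  · simp only [Nat.cast_zero, mul_zero, zero_mul] at h2
    linarith
  · exact h3

/-- The factor two before the logarithm squares `lam * δ / (8 * H * nS * nA)`, which cancels the `nS
^ 2` of the union bound. -/
theorem unionBound_le_of_sampleSizeKL_le {nS nA H N : ℕ} (hS : 0 < nS) (hA : 0 < nA) (hH : 0 < H)
    {ρ ε δ lam G : ℝ} (hρ : 0 < ρ) (hε : 0 < ε) (hδ : δ ∈ Set.Ioo (0 : ℝ) 1)
    (hlam : lam ∈ Set.Ioo (0 : ℝ) 1) (hG : 0 < G) (hGH : G ^ 2 ≤ 2 * Real.exp (H / lam) * H ^ 4)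
    (h : sampleSizeKL nS nA H ρ ε δ lam ≤ (N : ℝ) * nS * nA * H) :
    H * nS ^ 2 * nA * (2 * Real.exp (-2 * N * (ε * ρ / (G * Real.exp (H / lam))) ^ 2)) ≤ δ / 2 := by
  obtain ⟨-, h2⟩ := two_mul_log_le_of_sampleSizeKL_le hS hA hH hρ hε hδ hlam hG hGH h
  have hS' : (1 : ℝ) ≤ nS := Nat.one_le_cast.2 hS
  have hA' : (1 : ℝ) ≤ nA := Nat.one_le_cast.2 hA
  have hH' : (1 : ℝ) ≤ H := Nat.one_le_cast.2 hH
  have hlam0 := hlam.1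
  have hδ0 := hδ.1
  have h3 : Real.exp (-2 * N * (ε * ρ / (G * Real.exp (H / lam))) ^ 2) ≤
      (lam * δ / (8 * H * nS * nA)) ^ 2 := by
    calc _ ≤ Real.exp (-(2 * Real.log (8 * H * nS * nA / (lam * δ)))) :=
          Real.exp_le_exp.2 (by linarith)
      _ = (lam * δ / (8 * H * nS * nA)) ^ 2 := by
          rw [Real.exp_neg, mul_comm, Real.exp_mul, Real.exp_log (by positivity), ← inv_div,
            Real.rpow_two, inv_pow, inv_inv]
  calc _ ≤ H * nS ^ 2 * nA * (2 * (lam * δ / (8 * H * nS * nA)) ^ 2) := by gcongr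
    _ = (lam ^ 2 * δ) * δ / (32 * (H * nA)) := by field_simp; norm_num
    _ ≤ 1 * δ / (2 * 1) := by
        have e1 : lam ^ 2 * δ ≤ 1 :=
          mul_le_one₀ (pow_le_one₀ hlam0.le hlam.2.le) hδ0.le hδ.2.le
        have e2 : (1 : ℝ) ≤ H * nA := one_le_mul_of_one_le_of_one_le hH' hA'
        refine div_le_div₀ (by linarith) (mul_le_mul_of_nonneg_right e1 hδ0.le) (by norm_num) ?_
        linarith
    _ = δ / 2 := by ring

/-- Used at the stability threshold `η₀`, this produces an `N₀` free of `ε`. -/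
theorem exists_forall_unionBound_le {C η δ : ℝ} (hη : 0 < η) (hδ : 0 < δ) :
    ∃ N₀ : ℕ, ∀ N : ℕ, N₀ ≤ N → C * (2 * Real.exp (-2 * N * η ^ 2)) ≤ δ := by
  obtain ⟨N₀, hN₀⟩ := exists_nat_ge (C / (δ * η ^ 2))
  refine ⟨N₀, fun N hN => ?_⟩
  have h1 : C ≤ N * (δ * η ^ 2) :=
    (div_le_iff₀ (by positivity)).1 (hN₀.trans (Nat.cast_le.2 hN))
  have h2 : 2 * N * η ^ 2 ≤ Real.exp (2 * N * η ^ 2) := by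
    linarith [Real.add_one_le_exp (2 * N * η ^ 2)]
  have h3 : -2 * N * η ^ 2 = -(2 * N * η ^ 2) := by ring
  rw [h3, Real.exp_neg, ← mul_assoc, ← div_eq_mul_inv, div_le_iff₀ (Real.exp_pos _)]
  calc C * 2 ≤ δ * (2 * N * η ^ 2) := by linarith
    _ ≤ _ := mul_le_mul_of_nonneg_left h2 hδ.le

end SampleSize

/-! ### The two sample complexity bounds. -/

section Main

variable {S A : Type*} [Fintype S] [DecidableEq S] {H : ℕ}

theorem dualLowerBound_le [Finite A] (M : MDP S A H) (ρ : ℝ) (h : Fin H) (s : S) (a : A) :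
    M.dualLowerBound ρ ≤ if 0 < M.optDual ρ h s a ∧ M.optDual ρ h s a < 1
      then M.optDual ρ h s a / 2 else 1 / 2 :=
  ciInf_le (Set.finite_range fun i : Fin H × S × A =>
    if 0 < M.optDual ρ i.1 i.2.1 i.2.2 ∧ M.optDual ρ i.1 i.2.1 i.2.2 < 1
    then M.optDual ρ i.1 i.2.1 i.2.2 / 2 else 1 / 2).bddBelow (h, s, a)

theorem dualLowerBound_mem_Ioc [Finite A] [Nonempty S] [Nonempty A] (M : MDP S A H) (ρ : ℝ)
    (hH : 0 < H) : M.dualLowerBound ρ ∈ Set.Ioc (0 : ℝ) (1 / 2) := by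
  have : Nonempty (Fin H) := ⟨⟨0, hH⟩⟩
  obtain ⟨i, hi⟩ := exists_eq_ciInf_of_finite (f := fun i : Fin H × S × A =>
    if 0 < M.optDual ρ i.1 i.2.1 i.2.2 ∧ M.optDual ρ i.1 i.2.1 i.2.2 < 1
    then M.optDual ρ i.1 i.2.1 i.2.2 / 2 else 1 / 2)
  have hi' : M.dualLowerBound ρ = _ := hi.symm
  rw [hi']
  split_ifs with h
  · exact ⟨by linarith [h.1], by linarith [h.2]⟩
  · norm_num

theorem norm_optRobustValue_sub_robustValue_le [Finite A] [Nonempty A] (M : MDP S A H) {ρ : ℝ}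
    (hρ : 0 < ρ) {π : Policy S A H} {c : ℝ} (hc : 0 ≤ c)
    (h : ∀ s, |greedyValue M.reward M.trans ρ 0 s - bellmanValue M ρ π 0 s| ≤ c) :
    ‖M.optRobustValue ρ 0 - M.robustValue ρ π 0‖ ≤ c := by
  refine (pi_norm_le_iff_of_nonneg hc).2 fun s => ?_
  rw [Pi.sub_apply, optRobustValue_eq_greedyValue M hρ, robustValue_eq_bellmanValue M hρ,
    Real.norm_eq_abs]
  exact h s

/-- A deterministic threshold below which deviations of the empirical distribution functions at the
optimal values perturb the worst-case expectations with the constant given by `dualLowerBound`. -/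
theorem exists_abs_worstCase_optRobustValue_sub_le [Finite A] [Nonempty S] [Nonempty A]
    (M : MDP S A H) {ρ : ℝ} (hρ : 0 < ρ) (hH : 0 < H) :
    ∃ η₀ > 0, ∀ h s a, ∀ q ∈ stdSimplex ℝ S, (∀ s', M.trans h s a s' = 0 → q s' = 0) →
      ∀ η, 0 ≤ η → η ≤ η₀ →
      SublevelClose (M.trans h s a) q (greedyValue M.reward M.trans ρ h.succ) η →
      |worstCase (M.trans h s a) ρ (greedyValue M.reward M.trans ρ h.succ) -
        worstCase q ρ (greedyValue M.reward M.trans ρ h.succ)| ≤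
          H / ρ * Real.exp (H / M.dualLowerBound ρ) * η := by
  have : Nonempty (Fin H) := ⟨⟨0, hH⟩⟩
  have hopt : ∀ k, M.optRobustValue ρ k = greedyValue M.reward M.trans ρ k :=
    fun k => funext fun s => optRobustValue_eq_greedyValue M hρ k s
  choose f hf hf' using fun i : Fin H × S × A =>
    exists_abs_worstCase_sub_le (M.trans_mem i.1 i.2.1 i.2.2) hρ (Nat.cast_pos.2 hH)
      (greedyValue_mem_Icc_horizon M.reward_mem M.trans_mem hρ.le i.1.succ)
      (dualLowerBound_mem_Ioc M ρ hH).1 (by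
        have := dualLowerBound_le M ρ i.1 i.2.1 i.2.2
        rwa [MDP.optDual, hopt] at this)
  obtain ⟨i₀, hi₀⟩ := Finite.exists_min f
  exact ⟨f i₀, hf i₀, fun h s a q hq hqp η hη hle hcl =>
    hf' (h, s, a) q hq hqp η hη (hle.trans (hi₀ (h, s, a))) hcl⟩

variable [Fintype A] [Nonempty A] [Nonempty S] [MeasurableSpace S] [MeasurableSingletonClass S]

theorem IsGenerativeSample.measureReal_dualsBoundedBelow_le {M : MDP S A H} {ρ : ℝ} (hρ : 0 < ρ)
    {δ : ℝ} (hδ : δ ∈ Set.Ioo (0 : ℝ) 1) {lam : ℝ} (hlam : lam ∈ Set.Ioo (0 : ℝ) 1) {ε : ℝ}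
    (hε : ε ∈ Set.Ioo (0 : ℝ) H) {N : ℕ}
    (hN : sampleSizeKL (Fintype.card S) (Fintype.card A) H ρ ε δ lam ≤
      (N : ℝ) * Fintype.card S * Fintype.card A * H)
    {Ω : Type*} [MeasurableSpace Ω] {μ : Measure Ω} [IsProbabilityMeasure μ]
    {X : Ω → Dataset S A H N} (hX : IsGenerativeSample M μ X) :
    μ.real {ω | M.DualsBoundedBelow ρ lam (X ω) ∧
      ∃ π : Policy S A H, IsRPVLOutput M.reward ρ (X ω) π ∧
        ε < ‖M.optRobustValue ρ 0 - M.robustValue ρ π 0‖} ≤ δ := by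
  have hH' : (0 : ℝ) < H := hε.1.trans hε.2
  have hH : 0 < H := Nat.cast_pos.1 hH'
  have hE : 2 ≤ Real.exp (H / lam) := by
    have h1 := Real.add_one_le_exp ((H : ℝ) / lam)
    have h2 : (1 : ℝ) ≤ H := Nat.one_le_cast.2 hH
    have h3 : 1 ≤ (H : ℝ) / lam := (one_le_div hlam.1).2 (hlam.2.le.trans h2)
    linarith
  -- The factor `2 * H` comes from error propagation, the other `H` from the stability constant.
  have hG : (0 : ℝ) < 2 * H ^ 2 := by positivity
  have hGH : (2 * H ^ 2 : ℝ) ^ 2 ≤ 2 * Real.exp (H / lam) * H ^ 4 := by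
    have : (0 : ℝ) ≤ (H : ℝ) ^ 4 := by positivity
    nlinarith
  have hN0 := sampleSize_pos Fintype.card_pos Fintype.card_pos hH hρ hε.1 hδ hlam hG hGH hN
  have hb := unionBound_le_of_sampleSizeKL_le Fintype.card_pos Fintype.card_pos hH hρ hε.1 hδ hlam
    hG hGH hN
  set η := ε * ρ / (2 * H ^ 2 * Real.exp (H / lam)) with hη
  have hη0 : 0 ≤ η := div_nonneg (mul_nonneg hε.1.le hρ.le) (by positivity)
  have hc := hX.measureReal_not_sublevelClose_le hN0
    (V := fun D h => greedyValue M.reward (empirical D) ρ h.succ)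
    (fun h D D' hD => greedyValue_empirical_congr M.reward ρ D D' h.succ
      fun t ht => hD t (Fin.succ_le_castSucc_iff.1 ht)) hη0
  refine (measureReal_mono ?_).trans (hc.trans (hb.trans (by linarith [hδ.1])))
  rintro ω ⟨hdual, π, hπ, hlt⟩
  by_contra hcl
  rw [Set.mem_ofPred_eq] at hcl
  push Not at hcl
  refine hlt.not_ge (norm_optRobustValue_sub_robustValue_le M hρ hε.1.le fun s => ?_)
  have hD := empirical_mem_stdSimplex hN0 (X ω)
  have hval : 2 * (H - ((0 : Fin (H + 1)) : ℕ)) * (H / ρ * Real.exp (H / lam) * η) = ε := by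
    rw [hη]
    have := Real.exp_pos (H / lam)
    simp
    field_simp
  refine (abs_greedyValue_sub_bellmanValue_le M hρ.le hπ (fun h s a => ?_) 0 s).trans hval.le
  have hV := greedyValue_mem_Icc_horizon M.reward_mem hD hρ.le h.succ
  rw [abs_sub_comm]
  rcases hdual h s a with heq | ⟨h1, h2⟩
  · rw [rpvlValue_eq_greedyValue] at heq
    rw [heq, sub_self, abs_zero]
    positivity
  · exact (hcl h s a).abs_worstCase_sub_le (M.trans_mem h s a) (hD h s a) hρ hH'.le hV hη0 hlam.1
      h1 h2

theorem exists_forall_isGenerativeSample_le_measureReal (M : MDP S A H) {ρ : ℝ} (hρ : 0 < ρ)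
    {δ : ℝ} (hδ : δ ∈ Set.Ioo (0 : ℝ) 1) :
    ∃ N₀ : ℕ, ∀ ε ∈ Set.Ioo (0 : ℝ) H, ∀ N : ℕ, N₀ ≤ N →
      sampleSizeKL (Fintype.card S) (Fintype.card A) H ρ ε δ (M.dualLowerBound ρ) ≤
        (N : ℝ) * Fintype.card S * Fintype.card A * H →
      ∀ (Ω : Type*) [MeasurableSpace Ω] (μ : Measure Ω) [IsProbabilityMeasure μ]
        (X : Ω → Dataset S A H N), IsGenerativeSample M μ X →
        1 - δ ≤ μ.real {ω | ∀ π : Policy S A H, IsRPVLOutput M.reward ρ (X ω) π →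
          ‖M.optRobustValue ρ 0 - M.robustValue ρ π 0‖ ≤ ε} := by
  rcases Nat.eq_zero_or_pos H with rfl | hH
  · refine ⟨0, fun ε hε => ?_⟩
    simp at hε
  obtain ⟨η₀, hη₀, hstab⟩ := exists_abs_worstCase_optRobustValue_sub_le M hρ hH
  obtain ⟨N₀, hN₀⟩ := exists_forall_unionBound_le
    (C := H * Fintype.card S ^ 2 * Fintype.card A) hη₀ (half_pos hδ.1)
  refine ⟨N₀, fun ε hε N hNN₀ hN Ω _ μ _ X hX => ?_⟩
  have hH' : (0 : ℝ) < H := Nat.cast_pos.2 hH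
  have hH1 : (1 : ℝ) ≤ H := Nat.one_le_cast.2 hH
  obtain ⟨hlam0, hlam2⟩ := dualLowerBound_mem_Ioc M ρ hH
  set lam := M.dualLowerBound ρ
  -- Since `lam ≤ 1 / 2`, the exponent is at least `2 * H`, and the quadratic term of the
  -- exponential suffices.
  have hE : 2 * (H : ℝ) ^ 2 ≤ Real.exp (H / lam) := by
    have h1 : 2 * (H : ℝ) ≤ H / lam := (le_div_iff₀ hlam0).2 (by nlinarith)
    have h2 := Real.quadratic_le_exp_of_nonneg (show (0 : ℝ) ≤ 2 * H by positivity)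
    have h3 := Real.exp_le_exp.2 h1
    nlinarith
  -- Here `2 * H ^ 3` majorizes `H * (H + 1)` from propagation times `H` from the stability
  -- constant.
  have hG : (0 : ℝ) < 2 * H ^ 3 := by positivity
  have hGH : (2 * H ^ 3 : ℝ) ^ 2 ≤ 2 * Real.exp (H / lam) * H ^ 4 := by
    have := mul_le_mul_of_nonneg_right hE (show (0 : ℝ) ≤ 2 * (H : ℝ) ^ 4 by positivity)
    linarith
  have hlam : lam ∈ Set.Ioo (0 : ℝ) 1 := ⟨hlam0, by linarith⟩
  have hN0 := sampleSize_pos Fintype.card_pos Fintype.card_pos hH hρ hε.1 hδ hlam hG hGH hN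
  have hb := unionBound_le_of_sampleSizeKL_le Fintype.card_pos Fintype.card_pos hH hρ hε.1 hδ hlam
    hG hGH hN
  set η := ε * ρ / (2 * H ^ 3 * Real.exp (H / lam)) with hη
  have hη0 : 0 ≤ η := div_nonneg (mul_nonneg hε.1.le hρ.le) (by positivity)
  have hc : ∀ {η : ℝ}, 0 ≤ η → _ := fun hη => hX.measureReal_not_sublevelClose_le hN0
    (V := fun _ h => greedyValue M.reward M.trans ρ h.succ) (fun _ _ _ _ => rfl) hη
  have hc1 := (hc hη0).trans hb
  have hc2 := (hc hη₀.le).trans (hN₀ N hNN₀)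
  have hc3 := hX.measureReal_not_absolutelyContinuous
  -- Closeness at `η` gives the accuracy and closeness at `η₀` the validity of the stability
  -- estimate; each fails with probability at most `δ / 2`, and `B₃` is null.
  set B₁ := {ω | ∃ h s a, ¬ SublevelClose (M.trans h s a) (empirical (X ω) h s a)
    (greedyValue M.reward M.trans ρ h.succ) η}
  set B₂ := {ω | ∃ h s a, ¬ SublevelClose (M.trans h s a) (empirical (X ω) h s a)
    (greedyValue M.reward M.trans ρ h.succ) η₀}
  set B₃ := {ω | ∃ h s a s', M.trans h s a s' = 0 ∧ empirical (X ω) h s a s' ≠ 0}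
  set good := {ω | ∀ π : Policy S A H, IsRPVLOutput M.reward ρ (X ω) π →
    ‖M.optRobustValue ρ 0 - M.robustValue ρ π 0‖ ≤ ε}
  -- Covering the space and using subadditivity bounds `good` from below without its measurability.
  have hcover : Set.univ ⊆ good ∪ (B₁ ∪ (B₂ ∪ B₃)) := by
    intro ω _
    by_contra hω
    simp only [Set.mem_union, not_or] at hω
    obtain ⟨hgood, h1, h2, h3⟩ := hω
    refine hgood fun π hπ => norm_optRobustValue_sub_robustValue_le M hρ hε.1.le fun s => ?_
    simp only [B₁, B₂, B₃, Set.mem_ofPred_eq] at h1 h2 h3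
    push Not at h1 h2 h3
    have hD := empirical_mem_stdSimplex hN0 (X ω)
    have hval : (H - ((0 : Fin (H + 1)) : ℕ)) * (H - ((0 : Fin (H + 1)) : ℕ) + 1) *
        (H / ρ * Real.exp (H / lam) * η) ≤ ε := by
      have h4 : (H - ((0 : Fin (H + 1)) : ℕ)) * (H - ((0 : Fin (H + 1)) : ℕ) + 1) *
          (H / ρ * Real.exp (H / lam) * η) = (H + 1) / (2 * H) * ε := by
        rw [hη]
        have := Real.exp_pos (H / lam)
        simp
        field_simp
      rw [h4]
      exact mul_le_of_le_one_left hε.1.le ((div_le_one (by positivity)).2 (by linarith))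
    refine (abs_greedyValue_sub_bellmanValue_le_of_optimal M hρ.le hD hπ (fun h s a => ?_) 0 s).trans hval
    refine (hstab h s a _ (hD h s a) (h3 h s a) (min η η₀) (le_min hη0 hη₀.le) (min_le_right _ _)
      fun s' => le_min (h1 h s a s') (h2 h s a s')).trans ?_
    exact mul_le_mul_of_nonneg_left (min_le_left _ _) (by positivity)
  have htot : (1 : ℝ) ≤ μ.real good + (μ.real B₁ + (μ.real B₂ + μ.real B₃)) := by
    calc (1 : ℝ) = μ.real Set.univ := probReal_univ.symm
      _ ≤ μ.real (good ∪ (B₁ ∪ (B₂ ∪ B₃))) := measureReal_mono hcover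
      _ ≤ _ := (measureReal_union_le _ _).trans (add_le_add le_rfl
        ((measureReal_union_le _ _).trans (add_le_add le_rfl (measureReal_union_le _ _))))
  linarith

end Main

end RobustRL

end

open RobustRL in
theorem theorem3 {S A : Type*} [Fintype S] [Nonempty S] [DecidableEq S] [MeasurableSpace S]
    [MeasurableSingletonClass S] [Fintype A] [Nonempty A] {H : ℕ} (M : MDP S A H)
    (ρ : ℝ) (hρ : 0 < ρ) (δ : ℝ) (hδ : δ ∈ Set.Ioo (0 : ℝ) 1) :
    -- the sample complexity bound, for `N` above a threshold that does not depend on `ε`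
    (∃ N₀ : ℕ, ∀ ε ∈ Set.Ioo (0 : ℝ) H, ∀ N : ℕ, N₀ ≤ N →
      sampleSizeKL (Fintype.card S) (Fintype.card A) H ρ ε δ (M.dualLowerBound ρ) ≤
        (N : ℝ) * Fintype.card S * Fintype.card A * H →
      ∀ (Ω : Type*) [MeasurableSpace Ω] (μ : MeasureTheory.Measure Ω)
        [MeasureTheory.IsProbabilityMeasure μ] (X : Ω → Dataset S A H N),
        IsGenerativeSample M μ X →
        1 - δ ≤ μ.real {ω | ∀ π : Policy S A H, IsRPVLOutput M.reward ρ (X ω) π →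
          ‖M.optRobustValue ρ 0 - M.robustValue ρ π 0‖ ≤ ε}) ∧
    -- and without a threshold, on the event that the dual variables are bounded below
    (∀ lam ∈ Set.Ioo (0 : ℝ) 1, ∀ ε ∈ Set.Ioo (0 : ℝ) H, ∀ N : ℕ,
      sampleSizeKL (Fintype.card S) (Fintype.card A) H ρ ε δ lam ≤
        (N : ℝ) * Fintype.card S * Fintype.card A * H →
      ∀ (Ω : Type*) [MeasurableSpace Ω] (μ : MeasureTheory.Measure Ω)
        [MeasureTheory.IsProbabilityMeasure μ] (X : Ω → Dataset S A H N),
        IsGenerativeSample M μ X →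
        μ.real {ω | M.DualsBoundedBelow ρ lam (X ω) ∧
          ∃ π : Policy S A H, IsRPVLOutput M.reward ρ (X ω) π ∧
            ε < ‖M.optRobustValue ρ 0 - M.robustValue ρ π 0‖} ≤ δ) := by
  exact ⟨exists_forall_isGenerativeSample_le_measureReal M hρ hδ,
    fun _ hlam _ hε _ hN _ _ _ _ _ hX => hX.measureReal_dualsBoundedBelow_le hρ hδ hlam hε hN⟩
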